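/- Let $d_x,d_y,d_g$ be non-negative integers, let $\mathcal B\subset\mathbb R^{d_y}$ be open, let $g\in C^1(\mathbb R^{d_x}\times\mathcal B;\mathbb R^{d_g})$, and let $\mu_x$ be a Borel probability measure on $\mathbb R^{d_x}$. Write $D_yg(x,y)\in\mathbb R^{d_g\times d_y}$ for the Jacobian matrix of $g(x,\cdot)$ at $y$, and $\|\cdot\|_F$ for the Frobenius norm. Suppose that for some $p\in[1,\infty)$: 1. for every $y\in\mathcal B$, $g(\cdot,y)\in L^p_{\mu_x}(\mathbb R^{d_x};\mathbb R^{d_g})$, and the map $\mathcal B\ni y\mapsto g(\cdot,y)\in L^p_{\mu_x}(\mathbb R^{d_x};\mathbb R^{d_g})$ is continuous; 2. for every $y\in\mathcal B$, $D_yg(\cdot,y)\in L^p_{\mu_x}(\mathbb R^{d_x};\mathbb R^{d_g\times d_y})$, and the map $\mathcal B\ni y\mapsto D_yg(\cdot,y)\in L^p_{\mu_x}(\mathbb R^{d_x};\mathbb R^{d_g\times d_y})$ is continuous, where $\mathbb R^{d_g\times d_y}$ carries $\|\cdot\|_F$. A GELU neural network $g_\theta:\mathbb R^{d_x}\times\mathbb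 R^{d_y}\to\mathbb R^{d_g}$ is a map $g_\theta(x,y)=a_{L+1}$ with $a_0=(x,y)\in\mathbb R^{d_x+d_y}$, $a_i=\sigma(W_{i-1}a_{i-1}+b_{i-1})$ for $1\le i\le L$ and $a_{L+1}=W_La_L+b_L$, for some number $L\ge1$ of hidden layers, some finite widths, and some real weight matrices $W_i$ and bias vectors $b_i$ of matching sizes, where $\sigma(t)=t\,\Phi(t)$ is applied to each entry and $\Phi$ is the cumulative distribution function of the standard Gaussian distribution on $\mathbb R$. Then for any $\epsilon>0$ and any compact set $K_y\subset\mathcal B$ there exists a GELU neural network $g_\theta$ such that $$\sup_{y\in K_y}\Big(\mathbb E_{x\sim\mu_x}\big[\|g(x,y)-g_\theta(x,y)\|_2^p\big]+\mathbb E_{x\sim\mu_x}\big[\|D_yg(x,y)-D_yg_\theta(x,y)\|_F^p\big]\Big)<\epsilon^p .$$ (The supremum over an empty $K_y$ is $0$.) -/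

import Mathlib

open MeasureTheory ProbabilityTheory
open scoped ENNReal Matrix

-- Matrices carry the Frobenius norm throughout.
attribute [local instance] Matrix.frobeniusNormedAddCommGroup

/-- The Gaussian error linear unit `t ↦ t * Φ(t)`, with `Φ` the cumulative distribution function of
the standard Gaussian distribution on `ℝ`. -/
noncomputable def gelu (t : ℝ) : ℝ :=
  t * cdf (gaussianReal 0 1) t

/-- The parameters `θ` of a dense feedforward network from `ℝ^m` to `ℝ^n`: a list of weight matrices
and bias vectors of matching sizes. `hidden W b N` applies a hidden layer with weights `W` and
biases `b` first and `N` afterwards; the last layer is `output W b`. -/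
inductive DenseNet (n : ℕ) : ℕ → Type
  | output {m : ℕ} (W : Matrix (Fin n) (Fin m) ℝ) (b : Fin n → ℝ) : DenseNet n m
  | hidden {m k : ℕ} (W : Matrix (Fin k) (Fin m) ℝ) (b : Fin k → ℝ) (N : DenseNet n k) :
      DenseNet n m

namespace DenseNet

/-- The number of hidden layers. -/
def depth {n : ℕ} : {m : ℕ} → DenseNet n m → ℕ
  | _, output _ _ => 0
  | _, hidden _ _ N => N.depth + 1

/-- The map realized by a network with activation function `σ`: every hidden layer maps `a` to
`σ (W a + b)`, with `σ` applied to each entry, and the output layer maps `a` to `W a + b`. -/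
def eval (σ : ℝ → ℝ) {n : ℕ} : {m : ℕ} → DenseNet n m → (Fin m → ℝ) → Fin n → ℝ
  | _, output W b, a => W *ᵥ a + b
  | _, hidden W b N, a => N.eval σ (fun i => σ ((W *ᵥ a + b) i))

/-- The function `g_θ : ℝ^dx × ℝ^dy → ℝ^dg` of a GELU network whose input is the concatenation of
`x` and `y`. -/
noncomputable def toFun {dx dy dg : ℕ} (θ : DenseNet dg (dx + dy))
    (x : EuclideanSpace ℝ (Fin dx)) (y : EuclideanSpace ℝ (Fin dy)) :
    EuclideanSpace ℝ (Fin dg) :=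
  WithLp.toLp 2 (θ.eval gelu (Fin.append (fun i => x i) (fun j => y j)))

end DenseNet

/-- The partial Jacobian `D_y g(x, y)`, as a `dg × dy` matrix: its entry `(i, j)` is the derivative
of the `i`-th component of `g(x, ·)` at `y` in the direction of the `j`-th coordinate. -/
noncomputable def jacobianY {dx dy dg : ℕ}
    (g : EuclideanSpace ℝ (Fin dx) → EuclideanSpace ℝ (Fin dy) → EuclideanSpace ℝ (Fin dg))
    (x : EuclideanSpace ℝ (Fin dx)) (y : EuclideanSpace ℝ (Fin dy)) :
    Matrix (Fin dg) (Fin dy) ℝ :=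
  Matrix.of fun i j => fderiv ℝ (g x) y (EuclideanSpace.single j 1) i

/-! The argument approximates the `L^p`-valued map `y ↦ g(·, y)` in `C^1`, and every approximant
lies in a class that GELU networks reach uniformly.

Three properties of GELU suffice. The identity `gelu t - gelu (-t) = t` lets a layer pass values on
unchanged, so linear combinations and repeated applications of `gelu` fit into one dense network
(`exists_denseNet_of_isGeluNet`). The even part has a nondegenerate quadratic term at `0`, so its
rescalings tend to the square in `C^1` on bounded sets (`exists_rescaled_geluEven_near_sq`); by
polarization, bounded uniform limits of networks are closed under products (`NetApprox.mul`). A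
second difference of `gelu` is a decaying bump. Coordinates of `x` are unbounded and cannot be
multiplied in this way, but bumps in `x` can; by Stone–Weierstrass on the one-point compactification
they generate enough functions to approximate every element of `L^p(μ)`
(`exists_netApprox_eLpNorm_sub_le`).

Consequently, for a bump `k` in `y` and `a ∈ L^p(μ)`, the function `k(y) a(x)` and its
`y`-derivatives are limits of networks, uniformly in `y ∈ K` (`mem_netSubmodule_of_eq_smul`). The
jets with this property form a closed subspace, so they include integrals such as the convolution of
a compactly supported `L^p`-valued `C^1` function `H` with a narrow bump. The derivatives may be
moved onto `H` (`integral_kernelJets`), and as the bump narrows the convolution tends, up to a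
constant factor, to `H` in `C^1` (`mem_netSubmodule_of_hasLineDerivAt`).

This applies to each component of `g` times a cutoff in `y`. The hypotheses give continuity of the
values and of the pointwise derivatives in `L^p`; `hasDerivAt_Lp` shows that the pointwise
derivative is the `L^p`-valued one. -/

open Filter Topology

/-! ### The Gaussian error linear unit -/

/-- The standard Gaussian density. -/
noncomputable abbrev gaussDensity (t : ℝ) : ℝ := gaussianPDFReal 0 1 t

/-- The standard Gaussian cumulative distribution function. -/
noncomputable abbrev gaussCDF (t : ℝ) : ℝ := cdf (gaussianReal 0 1) t

lemma continuous_gaussDensity : Continuous gaussDensity := by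
  unfold gaussDensity gaussianPDFReal
  fun_prop

lemma gaussDensity_neg (t : ℝ) : gaussDensity (-t) = gaussDensity t := by
  simp [gaussDensity, gaussianPDFReal]

lemma differentiable_gaussDensity : Differentiable ℝ gaussDensity := by
  unfold gaussDensity gaussianPDFReal
  fun_prop

lemma gaussCDF_eq_integral (t : ℝ) : gaussCDF t = ∫ s in Set.Iic t, gaussDensity s := by
  rw [gaussCDF, cdf_eq_real, measureReal_def, gaussianReal_apply_eq_integral _ one_ne_zero,
    ENNReal.toReal_ofReal]
  exact integral_nonneg fun s => gaussianPDFReal_nonneg _ _ _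

lemma hasDerivAt_gaussCDF (t : ℝ) : HasDerivAt gaussCDF (gaussDensity t) t := by
  have h : gaussCDF = fun t => gaussCDF 0 + ∫ s in (0 : ℝ)..t, gaussDensity s := by
    ext t
    have hi : Integrable gaussDensity := integrable_gaussianPDFReal 0 1
    rw [gaussCDF_eq_integral, gaussCDF_eq_integral,
      ← intervalIntegral.integral_Iic_sub_Iic hi.integrableOn hi.integrableOn]
    ring
  rw [h]
  exact (intervalIntegral.integral_hasDerivAt_right
    (continuous_gaussDensity.intervalIntegrable _ _)
    (continuous_gaussDensity.stronglyMeasurableAtFilter _ _)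
    continuous_gaussDensity.continuousAt).const_add _

/-- The density is even, so `Φ(-t) + Φ(t)` has zero derivative; its limit at infinity fixes the
constant. -/
lemma gaussCDF_neg (t : ℝ) : gaussCDF (-t) = 1 - gaussCDF t := by
  have h1 : ∀ t, HasDerivAt (fun t => gaussCDF (-t) + gaussCDF t) 0 t := fun t => by
    have := ((hasDerivAt_gaussCDF (-t)).scomp t (hasDerivAt_neg t)).add (hasDerivAt_gaussCDF t)
    refine this.congr_deriv ?_
    simp [gaussDensity_neg]
  have h2 := is_const_of_deriv_eq_zero (fun t => (h1 t).differentiableAt) fun t => (h1 t).deriv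
  have h3 : Tendsto (fun t => gaussCDF (-t) + gaussCDF t) atTop (𝓝 (0 + 1)) :=
    ((tendsto_cdf_atBot _).comp tendsto_neg_atTop_atBot).add (tendsto_cdf_atTop _)
  have h4 := tendsto_nhds_unique h3 (tendsto_const_nhds.congr fun s => h2 t s)
  linarith

lemma hasDerivAt_gelu (t : ℝ) : HasDerivAt gelu (gaussCDF t + t * gaussDensity t) t :=
  ((hasDerivAt_id t).mul (hasDerivAt_gaussCDF t)).congr_deriv (by simp)

lemma contDiff_gelu : ContDiff ℝ 1 gelu := by
  rw [contDiff_one_iff_deriv]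
  refine ⟨fun t => (hasDerivAt_gelu t).differentiableAt, ?_⟩
  rw [funext fun t => (hasDerivAt_gelu t).deriv]
  exact (continuous_iff_continuousAt.2 fun t => (hasDerivAt_gaussCDF t).continuousAt).add
    (continuous_id.mul continuous_gaussDensity)

/-- Two neurons reproduce the identity exactly; this is how values survive a hidden layer. -/
lemma gelu_sub_gelu_neg (t : ℝ) : gelu t - gelu (-t) = t := by
  change t * gaussCDF t - -t * gaussCDF (-t) = t
  rw [gaussCDF_neg]; ring

/-- The even part of `gelu`, up to a factor `2`. -/
noncomputable def geluEven (t : ℝ) : ℝ := gelu t + gelu (-t)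

lemma geluEven_zero : geluEven 0 = 0 := by simp [geluEven, gelu]

lemma hasDerivAt_geluEven (t : ℝ) :
    HasDerivAt geluEven (2 * gaussCDF t - 1 + 2 * t * gaussDensity t) t := by
  have := (hasDerivAt_gelu t).add ((hasDerivAt_gelu (-t)).scomp t (hasDerivAt_neg t))
  refine this.congr_deriv ?_
  rw [gaussCDF_neg, gaussDensity_neg]; simp; ring

lemma gaussDensity_zero_pos : 0 < gaussDensity 0 := gaussianPDFReal_pos _ _ _ one_ne_zero

/-- The second-order coefficient is nonzero, which makes the square reachable by rescaling. Only the
second derivative at the point `0` is needed. -/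
lemma hasDerivAt_deriv_geluEven_zero : HasDerivAt (deriv geluEven) (4 * gaussDensity 0) 0 := by
  rw [funext fun t => (hasDerivAt_geluEven t).deriv]
  have := (((hasDerivAt_gaussCDF 0).const_mul 2).sub_const 1).add
    (((hasDerivAt_id (0 : ℝ)).const_mul 2).mul
      (differentiable_gaussDensity 0).hasDerivAt)
  refine this.congr_deriv ?_
  simp; ring

lemma deriv_geluEven_zero : deriv geluEven 0 = 0 := by
  rw [(hasDerivAt_geluEven 0).deriv]
  have := gaussCDF_neg 0
  rw [neg_zero] at this
  linarith

lemma differentiable_geluEven : Differentiable ℝ geluEven :=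
  fun t => (hasDerivAt_geluEven t).differentiableAt

/-- Rescalings of the even part of `gelu` approximate the square, uniformly on bounded sets and
together with the derivative. -/
lemma exists_rescaled_geluEven_near_sq (M η : ℝ) (hM : 0 < M) (hη : 0 < η) :
    ∃ c d : ℝ, ∀ u, |u| ≤ M → |u ^ 2 - c * geluEven (d * u)| ≤ η ∧
      |2 * u - c * (d * deriv geluEven (d * u))| ≤ η := by
  set a := 4 * gaussDensity 0 with ha
  have ha0 : 0 < a := by have := gaussDensity_zero_pos; positivity
  -- `τ` is the relative error of the Taylor expansion at `0`. The first entry of the minimum serves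
  -- the derivative estimate, the second the value estimate.
  set τ := min (η * a / (2 * M)) (η * a / (2 * M ^ 2)) with hτ
  have hτ0 : 0 < τ := by positivity
  have h1 := hasDerivAt_iff_isLittleO.1 hasDerivAt_deriv_geluEven_zero
  rw [Asymptotics.isLittleO_iff] at h1
  obtain ⟨r, hr, h2⟩ := Metric.eventually_nhds_iff_ball.1 (h1 hτ0)
  have h3 : ∀ t, |t| < r → |deriv geluEven t - a * t| ≤ τ * |t| := fun t ht => by
    have := h2 t (by simpa using ht)
    simpa [deriv_geluEven_zero, mul_comm t] using this
  have h4 : ∀ t, |t| < r → |geluEven t - a / 2 * t ^ 2| ≤ τ * |t| * |t| := fun t ht => by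
    have hd : ∀ s, HasDerivAt (fun s => geluEven s - a / 2 * s ^ 2) (deriv geluEven s - a * s) s :=
      fun s => by
        refine ((differentiable_geluEven s).hasDerivAt.sub
          ((hasDerivAt_pow 2 s).const_mul (a / 2))).congr_deriv ?_
        simp; ring
    -- The mean value inequality on the ball of radius `|t|` integrates the derivative bound `h3`.
    have := (convex_closedBall (0 : ℝ) |t|).norm_image_sub_le_of_norm_hasDerivWithin_le
      (C := τ * |t|) (fun s _ => (hd s).hasDerivWithinAt) (fun s hs => ?_)
      (x := 0) (y := t) (by simp) (by simp)
    · simpa [geluEven_zero] using this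
    · have hs' : |s| ≤ |t| := by simpa using hs
      exact (h3 s (hs'.trans_lt ht)).trans (by gcongr)
  -- With this `d`, all points `d * u` stay within `r / 2` of `0`; the outer factor `2 / (a * d ^
  -- 2)` normalizes the quadratic term.
  set d := r / (2 * M) with hd
  have hd0 : 0 < d := by positivity
  refine ⟨2 / (a * d ^ 2), d, fun u hu => ?_⟩
  have hdu : |d * u| < r := by
    rw [abs_mul, abs_of_pos hd0]
    calc d * |u| ≤ d * M := by gcongr
      _ = r / 2 := by rw [hd]; field_simp
      _ < r := by linarith
  constructor
  · have e : u ^ 2 - 2 / (a * d ^ 2) * geluEven (d * u) =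
        -(2 / (a * d ^ 2)) * (geluEven (d * u) - a / 2 * (d * u) ^ 2) := by
      field_simp; ring
    rw [e, abs_mul, abs_neg, abs_of_pos (by positivity)]
    calc _ ≤ 2 / (a * d ^ 2) * (τ * |d * u| * |d * u|) := by gcongr; exact h4 _ hdu
      _ = 2 / a * τ * |u| ^ 2 := by rw [abs_mul, abs_of_pos hd0]; field_simp
      _ ≤ 2 / a * (η * a / (2 * M ^ 2)) * M ^ 2 := by gcongr; exact min_le_right _ _
      _ = η := by field_simp
  · have e : 2 * u - 2 / (a * d ^ 2) * (d * deriv geluEven (d * u)) =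
        -(2 / (a * d)) * (deriv geluEven (d * u) - a * (d * u)) := by
      field_simp; ring
    rw [e, abs_mul, abs_neg, abs_of_pos (by positivity)]
    calc _ ≤ 2 / (a * d) * (τ * |d * u|) := by gcongr; exact h3 _ hdu
      _ = 2 / a * τ * |u| := by rw [abs_mul, abs_of_pos hd0]; field_simp
      _ ≤ 2 / a * (η * a / (2 * M)) * M := by gcongr; exact min_le_left _ _
      _ = η := by field_simp

/-! ### A bump built from `gelu` -/

lemma gaussCDF_nonneg (t : ℝ) : 0 ≤ gaussCDF t := cdf_nonneg _ _

/-- Chebyshev's inequality; quadratic decay is all that is needed of the Gaussian tail. -/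
lemma gaussCDF_neg_le {t : ℝ} (ht : 0 < t) : gaussCDF (-t) ≤ 1 / t ^ 2 := by
  have h := meas_ge_le_variance_div_sq (μ := gaussianReal 0 1) (X := id)
    (by simpa using memLp_id_gaussianReal (μ := 0) (v := 1) 2) ht
  rw [variance_id_gaussianReal] at h
  simp only [id, integral_id_gaussianReal, sub_zero] at h
  rw [gaussCDF, cdf_eq_real, measureReal_def]
  refine ENNReal.toReal_le_of_le_ofReal (by positivity) (le_trans (measure_mono ?_) h)
  intro x hx
  have : x ≤ -t := hx
  change t ≤ |x|
  exact le_abs.2 (Or.inr (by linarith))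

/-- The difference from ReLU has absolute value `|t| Φ(-|t|)`, to which the tail bound applies. -/
lemma abs_gelu_sub_max_le (t : ℝ) (ht : t ≠ 0) : |gelu t - max t 0| ≤ 1 / |t| := by
  have key : ∀ s, 0 < s → s * gaussCDF (-s) ≤ 1 / s := fun s hs => by
    calc s * gaussCDF (-s) ≤ s * (1 / s ^ 2) := by gcongr; exact gaussCDF_neg_le hs
      _ = 1 / s := by field_simp
  rcases lt_or_gt_of_ne ht with h | h
  · have h1 := key (-t) (by linarith)
    have h2 := gaussCDF_nonneg t
    rw [max_eq_right h.le, sub_zero, abs_of_neg h]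
    change |t * gaussCDF t| ≤ _
    rw [abs_mul, abs_of_neg h, abs_of_nonneg h2]
    simpa using h1
  · rw [max_eq_left h.le, abs_of_pos h]
    have e : gelu t - t = -(t * gaussCDF (-t)) := by
      change t * gaussCDF t - t = _
      rw [gaussCDF_neg]; ring
    rw [e, abs_neg, abs_of_nonneg (mul_nonneg h.le (gaussCDF_nonneg _))]
    exact key t h

/-- A second difference of `gelu`. -/
noncomputable def geluBump (t : ℝ) : ℝ := gelu (t + 1) - 2 * gelu t + gelu (t - 1)

lemma contDiff_geluBump : ContDiff ℝ 1 geluBump := by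
  have := contDiff_gelu
  unfold geluBump
  fun_prop

lemma geluBump_zero_pos : 0 < geluBump 0 := by
  have h1 : StrictMono gaussCDF := strictMono_of_deriv_pos fun t => by
    rw [(hasDerivAt_gaussCDF t).deriv]
    exact gaussianPDFReal_pos _ _ _ one_ne_zero
  have h2 := h1 (show (-1 : ℝ) < 1 by norm_num)
  have e : geluBump 0 = gaussCDF 1 - gaussCDF (-1) := by
    simp [geluBump, gelu]; ring
  rw [e]; linarith

/-- The same second difference of ReLU vanishes here, so only the three errors between GELU and ReLU
remain, with weights `1`, `2`, `1`. -/
lemma abs_geluBump_le_of_two_le {t : ℝ} (ht : 2 ≤ |t|) : |geluBump t| ≤ 12 * (1 + |t|)⁻¹ := by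
  have h0 : max (t + 1) 0 - 2 * max t 0 + max (t - 1) 0 = 0 := by
    rcases le_abs.1 ht with h | h
    · rw [max_eq_left (by linarith), max_eq_left (by linarith), max_eq_left (by linarith)]; ring
    · rw [max_eq_right (by linarith), max_eq_right (by linarith), max_eq_right (by linarith)]; ring
  have e : geluBump t = (gelu (t + 1) - max (t + 1) 0) - 2 * (gelu t - max t 0) +
      (gelu (t - 1) - max (t - 1) 0) := by
    rw [geluBump]; linarith
  -- The factor `3` comes from `1 + |t| ≤ 3 (|t| - 1)` for `|t| ≥ 2`.
  have key : ∀ s, |t| - 1 ≤ |s| → |gelu s - max s 0| ≤ 3 * (1 + |t|)⁻¹ := fun s hs => by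
    have hs0 : 0 < |s| := by linarith
    refine (abs_gelu_sub_max_le s (abs_pos.1 hs0)).trans ?_
    rw [← div_eq_mul_inv, div_le_div_iff₀ hs0 (by positivity)]
    linarith
  have k1 := key (t + 1) (by
    have := abs_sub_abs_le_abs_sub t (-1); simp at this; linarith)
  have k2 := key t (by linarith)
  have k3 := key (t - 1) (by
    have := abs_sub_abs_le_abs_sub t 1; simp at this; linarith)
  rw [e]
  rw [abs_le] at k1 k2 k3 ⊢
  constructor <;> linarith

lemma exists_abs_geluBump_le : ∃ C, 0 < C ∧ ∀ t, |geluBump t| ≤ C * (1 + |t|)⁻¹ := by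
  obtain ⟨D, hD⟩ := (isCompact_Icc (a := (-2 : ℝ)) (b := 2)).exists_bound_of_continuousOn
    contDiff_geluBump.continuous.continuousOn
  refine ⟨12 + 3 * |D|, by positivity, fun t => ?_⟩
  rcases le_or_gt 2 |t| with h | h
  · refine (abs_geluBump_le_of_two_le h).trans ?_
    gcongr
    linarith [abs_nonneg D]
  · have h1 := hD t (abs_le.1 h.le)
    rw [Real.norm_eq_abs] at h1
    refine (h1.trans (le_abs_self D)).trans ?_
    rw [← div_eq_mul_inv, le_div_iff₀ (by positivity)]
    nlinarith [abs_nonneg D, abs_nonneg t]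

/-- Squaring turns the decay bound `1 / |t|`, which is not integrable, into an integrable one. -/
lemma integrable_geluBump_sq : Integrable fun t => geluBump t ^ 2 := by
  obtain ⟨C, hC, h⟩ := exists_abs_geluBump_le
  refine (integrable_inv_one_add_sq.const_mul (C ^ 2)).mono'
    (contDiff_geluBump.continuous.pow 2).aestronglyMeasurable (ae_of_all _ fun t => ?_)
  rw [norm_pow, Real.norm_eq_abs]
  calc |geluBump t| ^ 2 ≤ (C * (1 + |t|)⁻¹) ^ 2 := by gcongr; exact h t
    _ = C ^ 2 * ((1 + |t|) ^ 2)⁻¹ := by rw [mul_pow, inv_pow]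
    _ ≤ C ^ 2 * (1 + t ^ 2)⁻¹ := by
      gcongr
      nlinarith [abs_nonneg t, sq_abs t]

/-! ### Composition of networks -/

namespace DenseNet

/-- Precomposition of a network with an affine map. -/
def affineComp {n m k : ℕ} (V : Matrix (Fin k) (Fin m) ℝ) (c : Fin k → ℝ) :
    DenseNet n k → DenseNet n m
  | output W b => output (W * V) (W *ᵥ c + b)
  | hidden W b N => hidden (W * V) (W *ᵥ c + b) N

lemma depth_affineComp {n m k : ℕ} (V : Matrix (Fin k) (Fin m) ℝ) (c : Fin k → ℝ)
    (N : DenseNet n k) : (N.affineComp V c).depth = N.depth := by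
  cases N <;> rfl

lemma eval_affineComp (σ : ℝ → ℝ) {n m k : ℕ} (V : Matrix (Fin k) (Fin m) ℝ) (c : Fin k → ℝ)
    (N : DenseNet n k) (a : Fin m → ℝ) :
    (N.affineComp V c).eval σ a = N.eval σ (V *ᵥ a + c) := by
  cases N <;> simp [affineComp, eval, Matrix.mulVec_add, add_assoc]

/-- The network that runs the second network on the output of the first. -/
def andThen {n k : ℕ} : {m : ℕ} → DenseNet k m → DenseNet n k → DenseNet n m
  | _, output W b, N => N.affineComp W b
  | _, hidden W b M, N => hidden W b (M.andThen N)

lemma depth_andThen {n k m : ℕ} (M : DenseNet k m) (N : DenseNet n k) :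
    (M.andThen N).depth = M.depth + N.depth := by
  induction M with
  | output W b => simp [andThen, depth, depth_affineComp]
  | hidden W b M ih => simp [andThen, depth, ih]; ring

lemma eval_andThen (σ : ℝ → ℝ) {n k m : ℕ} (M : DenseNet k m) (N : DenseNet n k)
    (a : Fin m → ℝ) : (M.andThen N).eval σ a = N.eval σ (M.eval σ a) := by
  induction M with
  | output W b => simp [andThen, eval, eval_affineComp]
  | hidden W b M ih => simp [andThen, eval, ih]

end DenseNet

/-! ### Functions computed by GELU networks -/

/-- The functions obtained from the coordinates of `inp` and constants by linear combinations and
applications of `gelu`. -/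
inductive IsGeluNet {α : Type} {m : ℕ} (inp : α → Fin m → ℝ) : (α → ℝ) → Prop
  | const (c : ℝ) : IsGeluNet inp fun _ => c
  | input (i : Fin m) : IsGeluNet inp fun a => inp a i
  | add {f g : α → ℝ} : IsGeluNet inp f → IsGeluNet inp g → IsGeluNet inp fun a => f a + g a
  | smul (c : ℝ) {f : α → ℝ} : IsGeluNet inp f → IsGeluNet inp fun a => c * f a
  | gelu {f : α → ℝ} : IsGeluNet inp f → IsGeluNet inp fun a => gelu (f a)

section Realization

variable {α : Type} {m : ℕ} {inp : α → Fin m → ℝ}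

/-- The family `F` is computed by a network with `l` hidden layers. -/
def Realizable (inp : α → Fin m → ℝ) (l : ℕ) {ι : Type} (F : α → ι → ℝ) : Prop :=
  ∃ (n : ℕ) (e : ι ≃ Fin n) (θ : DenseNet n m), θ.depth = l ∧
    ∀ a i, θ.eval gelu (inp a) (e i) = F a i

lemma realizable_input : Realizable inp 0 inp :=
  ⟨m, Equiv.refl _, .output 1 0, rfl, fun a i => by simp [DenseNet.eval]⟩

lemma Realizable.affine {ι κ : Type} [Fintype ι] [Fintype κ] {l : ℕ} {F : α → ι → ℝ}
    (hF : Realizable inp l F) (W : Matrix κ ι ℝ) (b : κ → ℝ) :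
    Realizable inp l fun a => W *ᵥ F a + b := by
  obtain ⟨n, e, θ, rfl, h⟩ := hF
  refine ⟨Fintype.card κ, Fintype.equivFin κ, θ.andThen (.output
    (W.submatrix (Fintype.equivFin κ).symm e.symm) (b ∘ (Fintype.equivFin κ).symm)), ?_, ?_⟩
  · simp [DenseNet.depth_andThen, DenseNet.depth]
  · intro a i
    have : F a = θ.eval gelu (inp a) ∘ e := funext fun i => (h a i).symm
    simp [DenseNet.eval_andThen, DenseNet.eval, this, Matrix.submatrix_mulVec_equiv]

lemma Realizable.layer {ι κ : Type} [Fintype ι] [Fintype κ] {l : ℕ} {F : α → ι → ℝ}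
    (hF : Realizable inp l F) (W : Matrix κ ι ℝ) (b : κ → ℝ) :
    Realizable inp (l + 1) fun a i => gelu ((W *ᵥ F a + b) i) := by
  obtain ⟨n, e, θ, rfl, h⟩ := hF.affine W b
  refine ⟨n, e, θ.andThen (.hidden (1 : Matrix (Fin n) (Fin n) ℝ) 0
    (.output (1 : Matrix (Fin n) (Fin n) ℝ) 0)), ?_, ?_⟩
  · simp [DenseNet.depth_andThen, DenseNet.depth]
  · intro a i
    simp [DenseNet.eval_andThen, DenseNet.eval, h]

/-- `f` is an affine combination of the members of the family `F`. -/
def IsReadout {ι : Type} [Fintype ι] (F : α → ι → ℝ) (f : α → ℝ) : Prop :=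
  ∃ (w : ι → ℝ) (c : ℝ), ∀ a, f a = w ⬝ᵥ F a + c

/-- The hidden layer holds `gelu (F i)`, `gelu (-F i)` and `gelu f`; the output map subtracts the
first two to recover `F i`. Hence nothing computed earlier is lost. -/
lemma Realizable.extend {ι : Type} [Fintype ι] {l : ℕ} {F : α → ι → ℝ}
    (hF : Realizable inp l F) {f : α → ℝ} (hf : IsReadout F f) :
    Realizable inp (l + 1) fun a => Sum.elim (F a) fun _ : Unit => gelu (f a) := by
  classical
  obtain ⟨w, c, hw⟩ := hf
  have h1 := hF.layer (κ := (ι ⊕ ι) ⊕ Unit)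
    (Matrix.fromRows (Matrix.fromRows 1 (-1)) (Matrix.of fun _ => w))
    (Sum.elim 0 fun _ => c)
  have h2 := h1.affine (κ := ι ⊕ Unit)
    (Matrix.fromBlocks (Matrix.fromCols 1 (-1)) 0 0 1) 0
  convert h2 using 1
  funext a i
  rcases i with i | i
  · simp [Matrix.fromBlocks_mulVec, Matrix.fromRows_mulVec, Matrix.fromCols_mulVec,
      Matrix.neg_mulVec, Function.comp_def, ← sub_eq_add_neg, gelu_sub_gelu_neg]
  · simp [Matrix.fromBlocks_mulVec, Matrix.fromRows_mulVec, hw]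
    rfl

/-- The starting family is arbitrary so that, for a sum, the network of the second term can be
stacked on that of the first, with every earlier readout still available. -/
lemma IsGeluNet.exists_readout {f : α → ℝ} (hf : IsGeluNet inp f) :
    ∀ {ι : Type} [Fintype ι] {l : ℕ} {F : α → ι → ℝ}, Realizable inp l F →
      (∀ i, IsReadout F fun a => inp a i) →
      ∃ (κ : Type) (_ : Fintype κ) (l' : ℕ) (G : α → κ → ℝ), Realizable inp l' G ∧
        (∀ h, IsReadout F h → IsReadout G h) ∧ IsReadout G f := by
  induction hf with
  | const c =>
    intro ι _ l F hF _
    exact ⟨ι, inferInstance, l, F, hF, fun _ h => h, 0, c, by simp⟩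
  | input i =>
    intro ι _ l F hF hi
    exact ⟨ι, inferInstance, l, F, hF, fun _ h => h, hi i⟩
  | add _ _ ih1 ih2 =>
    intro ι _ l F hF hi
    obtain ⟨κ, _, l', G, hG, h1, h2⟩ := ih1 hF hi
    obtain ⟨κ', _, l'', G', hG', h1', h2'⟩ := ih2 hG fun i => h1 _ (hi i)
    obtain ⟨w, c, hw⟩ := h1' _ h2
    obtain ⟨w', c', hw'⟩ := h2'
    exact ⟨κ', inferInstance, l'', G', hG', fun h hh => h1' h (h1 h hh), w + w', c + c',
      fun a => by simp only [hw, hw', add_dotProduct]; ring⟩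
  | smul r _ ih =>
    intro ι _ l F hF hi
    obtain ⟨κ, _, l', G, hG, h1, w, c, hw⟩ := ih hF hi
    exact ⟨κ, inferInstance, l', G, hG, h1, r • w, r * c,
      fun a => by simp only [hw, smul_dotProduct, smul_eq_mul]; ring⟩
  | gelu _ ih =>
    intro ι _ l F hF hi
    obtain ⟨κ, _, l', G, hG, h1, h2⟩ := ih hF hi
    refine ⟨κ ⊕ Unit, inferInstance, l' + 1, _, hG.extend h2, fun h hh => ?_,
      Sum.elim 0 1, 0, fun a => ?_⟩
    · obtain ⟨w, c, hw⟩ := h1 h hh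
      exact ⟨Sum.elim w 0, c, fun a => by simp [hw, sumElim_dotProduct_sumElim]⟩
    · simp [dotProduct]

/-- Finitely many functions computed by GELU networks are the components of one network. -/
lemma exists_denseNet_of_isGeluNet {n : ℕ} (f : Fin n → α → ℝ) (hf : ∀ i, IsGeluNet inp (f i)) :
    ∃ θ : DenseNet n m, 0 < θ.depth ∧ ∀ a, θ.eval gelu (inp a) = fun i => f i a := by
  have key : ∀ s : Finset (Fin n),
      ∃ (κ : Type) (_ : Fintype κ) (l : ℕ) (G : α → κ → ℝ), Realizable inp l G ∧
        (∀ i, IsReadout G fun a => inp a i) ∧ ∀ i ∈ s, IsReadout G (f i) := by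
    intro s
    induction s using Finset.induction_on with
    | empty =>
      exact ⟨Fin m, inferInstance, 0, inp, realizable_input,
        fun i => ⟨Pi.single i 1, 0, fun a => by simp⟩, by simp⟩
    | insert i s _ ih =>
      obtain ⟨κ, _, l, G, hG, h1, h2⟩ := ih
      obtain ⟨κ', _, l', G', hG', h1', h2'⟩ := (hf i).exists_readout hG h1
      refine ⟨κ', inferInstance, l', G', hG', fun i => h1' _ (h1 i), fun j hj => ?_⟩
      rcases Finset.mem_insert.1 hj with rfl | hj
      · exact h2'
      · exact h1' _ (h2 j hj)
  obtain ⟨κ, _, l, G, hG, -, h⟩ := key Finset.univ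
  choose w c hw using fun i => h i (Finset.mem_univ i)
  have h1 := (hG.extend (f := fun _ => 0) ⟨0, 0, by simp⟩).affine
    (Matrix.of fun i : Fin n => Sum.elim (w i) 0) c
  obtain ⟨n', e, θ, hθ, h2⟩ := h1
  obtain rfl : n = n' := by simpa using Fintype.card_congr e
  -- The last matrix undoes the permutation `e` of the outputs.
  refine ⟨θ.andThen (.output (Matrix.submatrix 1 e id) 0), ?_, fun a => ?_⟩
  · simp [DenseNet.depth_andThen, hθ]
  · have h3 : θ.eval gelu (inp a) ∘ e = fun i => f i a := funext fun i => by
      rw [Function.comp_apply, h2, hw]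
      simp [Matrix.mulVec, sumElim_dotProduct_sumElim]
    rw [← h3, DenseNet.eval_andThen]
    funext i
    simp [DenseNet.eval, Matrix.mulVec, dotProduct, Matrix.one_apply]

end Realization

/-! ### Partial derivatives in the second variable -/

/-- Euclidean space of dimension `n`. -/
abbrev Euc (n : ℕ) := EuclideanSpace ℝ (Fin n)

section PartialDerivative

variable {X Y : Type*} [NormedAddCommGroup Y] [NormedSpace ℝ Y]

/-- The derivative of `f (x, ·)` at `y`. -/
noncomputable def fderivSnd (f : X × Y → ℝ) (z : X × Y) : Y →L[ℝ] ℝ :=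
  fderiv ℝ (fun y => f (z.1, y)) z.2

lemma fderivSnd_fst (b : X → ℝ) (z : X × Y) : fderivSnd (fun z => b z.1) z = 0 :=
  (hasFDerivAt_const (b z.1) z.2).fderiv

variable [NormedAddCommGroup X] [NormedSpace ℝ X]

lemma fderivSnd_eq {f : X × Y → ℝ} (hf : ContDiff ℝ 1 f) (z : X × Y) :
    fderivSnd f z = (fderiv ℝ f z).comp (ContinuousLinearMap.inr ℝ X Y) := by
  have h1 : HasFDerivAt f (fderiv ℝ f z) (z.1, z.2) :=
    (hf.differentiable one_ne_zero z).hasFDerivAt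
  exact (h1.comp z.2 (hasFDerivAt_prodMk_right z.1 z.2)).fderiv

lemma ContDiff.continuous_fderivSnd {f : X × Y → ℝ} (hf : ContDiff ℝ 1 f) :
    Continuous (fderivSnd f) := by
  rw [funext (fderivSnd_eq hf)]
  exact (hf.continuous_fderiv one_ne_zero).clm_comp continuous_const

lemma ContDiff.hasFDerivAt_fderivSnd {f : X × Y → ℝ} (hf : ContDiff ℝ 1 f) (z : X × Y) :
    HasFDerivAt (fun y => f (z.1, y)) (fderivSnd f z) z.2 := by
  have : Differentiable ℝ fun y => f (z.1, y) :=
    (hf.differentiable one_ne_zero).comp (differentiable_const _ |>.prodMk differentiable_id)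
  exact (this z.2).hasFDerivAt

lemma fderivSnd_add {f g : X × Y → ℝ} (hf : ContDiff ℝ 1 f) (hg : ContDiff ℝ 1 g) (z : X × Y) :
    fderivSnd (fun z => f z + g z) z = fderivSnd f z + fderivSnd g z :=
  ((hf.hasFDerivAt_fderivSnd z).add (hg.hasFDerivAt_fderivSnd z)).fderiv

lemma fderivSnd_smul {f : X × Y → ℝ} (hf : ContDiff ℝ 1 f) (c : ℝ) (z : X × Y) :
    fderivSnd (fun z => c * f z) z = c • fderivSnd f z :=
  ((hf.hasFDerivAt_fderivSnd z).const_mul c).fderiv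

lemma fderivSnd_comp {f : X × Y → ℝ} (hf : ContDiff ℝ 1 f) {s : ℝ → ℝ} (hs : Differentiable ℝ s)
    (z : X × Y) : fderivSnd (fun z => s (f z)) z = deriv s (f z) • fderivSnd f z :=
  ((hs (f z)).hasDerivAt.comp_hasFDerivAt z.2 (hf.hasFDerivAt_fderivSnd z)).fderiv

end PartialDerivative

/-! ### Uniform limits of networks -/

/-- The concatenation of `x` and `y`. -/
def netInput {dx dy : ℕ} (z : Euc dx × Euc dy) : Fin (dx + dy) → ℝ :=
  Fin.append (fun i => z.1 i) fun j => z.2 j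

section NetApprox

variable {dx dy : ℕ}

lemma IsGeluNet.fst (i : Fin dx) :
    IsGeluNet (netInput (dy := dy)) fun z : Euc dx × Euc dy => z.1 i := by
  simpa [netInput] using IsGeluNet.input (inp := netInput) (Fin.castAdd dy i)

lemma IsGeluNet.snd (j : Fin dy) :
    IsGeluNet (netInput (dx := dx)) fun z : Euc dx × Euc dy => z.2 j := by
  simpa [netInput] using IsGeluNet.input (inp := netInput) (Fin.natAdd dx j)

lemma IsGeluNet.contDiff {f : Euc dx × Euc dy → ℝ} (hf : IsGeluNet netInput f) :
    ContDiff ℝ 1 f := by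
  induction hf with
  | const c => fun_prop
  | input i =>
    refine Fin.addCases (fun i => ?_) (fun j => ?_) i
    · simp only [netInput, Fin.append_left]; fun_prop
    · simp only [netInput, Fin.append_right]; fun_prop
  | add _ _ h1 h2 => exact h1.add h2
  | smul c _ h => exact contDiff_const.mul h
  | gelu _ h => exact contDiff_gelu.comp h

lemma IsGeluNet.geluEven {f : Euc dx × Euc dy → ℝ} (hf : IsGeluNet netInput f) :
    IsGeluNet netInput fun z => geluEven (f z) := by
  simpa [_root_.geluEven] using hf.gelu.add (hf.smul (-1)).gelu

lemma IsGeluNet.geluBump {f : Euc dx × Euc dy → ℝ} (hf : IsGeluNet netInput f) :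
    IsGeluNet netInput fun z => geluBump (f z) := by
  have := ((hf.add (.const 1)).gelu.add (hf.gelu.smul (-2))).add (hf.add (.const (-1))).gelu
  convert this using 2 with z
  rw [_root_.geluBump]; ring_nf

/-- `f` is continuously differentiable, is bounded with bounded `y`-derivative for `y ∈ K`, and is
together with its `y`-derivative the uniform limit for `y ∈ K` of functions computed by GELU
networks. -/
structure NetApprox (K : Set (Euc dy)) (f : Euc dx × Euc dy → ℝ) : Prop where
  contDiff : ContDiff ℝ 1 f
  bounded : ∃ M, 0 < M ∧ ∀ x, ∀ y ∈ K, |f (x, y)| ≤ M ∧ ‖fderivSnd f (x, y)‖ ≤ M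
  approx : ∀ ε > 0, ∃ n, IsGeluNet netInput n ∧ ∀ x, ∀ y ∈ K,
    |f (x, y) - n (x, y)| ≤ ε ∧ ‖fderivSnd f (x, y) - fderivSnd n (x, y)‖ ≤ ε

variable {K : Set (Euc dy)} {f g : Euc dx × Euc dy → ℝ}

lemma IsGeluNet.netApprox (hf : IsGeluNet netInput f)
    (hb : ∃ M, 0 < M ∧ ∀ x, ∀ y ∈ K, |f (x, y)| ≤ M ∧ ‖fderivSnd f (x, y)‖ ≤ M) :
    NetApprox K f :=
  ⟨hf.contDiff, hb, fun ε hε => ⟨f, hf, fun x y _ => by simp [hε.le]⟩⟩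

lemma netApprox_const (c : ℝ) : NetApprox K fun _ : Euc dx × Euc dy => c := by
  refine (IsGeluNet.const c).netApprox ⟨|c| + 1, by positivity, fun x y _ => ⟨by simp, ?_⟩⟩
  have : fderivSnd (fun _ : Euc dx × Euc dy => c) (x, y) = 0 := fderivSnd_fst (fun _ => c) _
  rw [this, norm_zero]; positivity

lemma NetApprox.add (hf : NetApprox K f) (hg : NetApprox K g) :
    NetApprox K fun z => f z + g z := by
  obtain ⟨M, hM, hfM⟩ := hf.bounded
  obtain ⟨M', hM', hgM⟩ := hg.bounded
  refine ⟨hf.contDiff.add hg.contDiff, ⟨M + M', by positivity, fun x y hy => ⟨?_, ?_⟩⟩,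
    fun ε hε => ?_⟩
  · exact (abs_add_le _ _).trans (add_le_add (hfM x y hy).1 (hgM x y hy).1)
  · rw [fderivSnd_add hf.contDiff hg.contDiff]
    exact (norm_add_le _ _).trans (add_le_add (hfM x y hy).2 (hgM x y hy).2)
  · obtain ⟨n, hn, hfn⟩ := hf.approx (ε / 2) (half_pos hε)
    obtain ⟨n', hn', hgn⟩ := hg.approx (ε / 2) (half_pos hε)
    refine ⟨_, hn.add hn', fun x y hy => ⟨?_, ?_⟩⟩
    · rw [add_sub_add_comm, ← add_halves ε]
      exact (abs_add_le _ _).trans (add_le_add (hfn x y hy).1 (hgn x y hy).1)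
    · rw [fderivSnd_add hf.contDiff hg.contDiff, fderivSnd_add hn.contDiff hn'.contDiff,
        add_sub_add_comm, ← add_halves ε]
      exact (norm_add_le _ _).trans (add_le_add (hfn x y hy).2 (hgn x y hy).2)

lemma NetApprox.smul (c : ℝ) (hf : NetApprox K f) : NetApprox K fun z => c * f z := by
  obtain ⟨M, hM, hfM⟩ := hf.bounded
  refine ⟨contDiff_const.mul hf.contDiff, ⟨(|c| + 1) * M, by positivity,
    fun x y hy => ⟨?_, ?_⟩⟩, fun ε hε => ?_⟩
  · rw [abs_mul]
    gcongr
    · linarith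
    · exact (hfM x y hy).1
  · rw [fderivSnd_smul hf.contDiff, norm_smul, Real.norm_eq_abs]
    gcongr
    · linarith
    · exact (hfM x y hy).2
  · obtain ⟨n, hn, hfn⟩ := hf.approx (ε / (|c| + 1)) (by positivity)
    have key : ∀ t, t ≤ ε / (|c| + 1) → |c| * t ≤ ε := fun t ht => by
      calc |c| * t ≤ |c| * (ε / (|c| + 1)) := by gcongr
        _ ≤ (|c| + 1) * (ε / (|c| + 1)) := by gcongr; linarith
        _ = ε := by field_simp
    refine ⟨_, hn.smul c, fun x y hy => ⟨?_, ?_⟩⟩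
    · rw [← mul_sub, abs_mul]
      exact key _ (hfn x y hy).1
    · have e : c • fderivSnd f (x, y) - c • fderivSnd n (x, y) =
          c • (fderivSnd f (x, y) - fderivSnd n (x, y)) := by module
      rw [fderivSnd_smul hf.contDiff, fderivSnd_smul hn.contDiff, e, norm_smul,
        Real.norm_eq_abs]
      exact key _ (hfn x y hy).2

/-- A network `n` near `f` is fed into a rescaled `geluEven`. Boundedness of `f` keeps the values of
`n` in a fixed interval, where that rescaling is `C^1`-close to the square. -/
lemma NetApprox.sq (hf : NetApprox K f) : NetApprox K fun z => f z ^ 2 := by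
  obtain ⟨M, hM, hfM⟩ := hf.bounded
  have hder : ∀ {h : Euc dx × Euc dy → ℝ}, ContDiff ℝ 1 h → ∀ z,
      fderivSnd (fun z => h z ^ 2) z = (2 * h z) • fderivSnd h z := fun hh z => by
    rw [fderivSnd_comp hh (differentiable_pow 2)]; simp
  refine ⟨hf.contDiff.pow 2, ⟨(1 + 2 * M) * M, by positivity, fun x y hy => ⟨?_, ?_⟩⟩,
    fun ε hε => ?_⟩
  · rw [abs_pow, pow_two]
    have := (hfM x y hy).1
    gcongr
    linarith
  · rw [hder hf.contDiff, norm_smul, norm_mul, Real.norm_eq_abs, Real.norm_eq_abs]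
    have := (hfM x y hy).1
    gcongr
    · rw [abs_two]; linarith
    · exact (hfM x y hy).2
  -- `η ≤ 1` bounds `n` and its derivative by `M + 1`. The total errors are `2 (M + 1) η` for the
  -- value and `(5 M + 3) η` for the derivative.
  · set η := min 1 (ε / (8 * (M + 1))) with hη
    have hη0 : 0 < η := by positivity
    have hη1 : η ≤ 1 := min_le_left _ _
    have hη2 : η * (8 * (M + 1)) ≤ ε := by
      rw [← le_div_iff₀ (by positivity)]; exact min_le_right _ _
    obtain ⟨n, hn, hfn⟩ := hf.approx η hη0
    obtain ⟨c, d, hcd⟩ := exists_rescaled_geluEven_near_sq (M + 1) η (by positivity) hη0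
    refine ⟨_, ((hn.smul d).geluEven).smul c, fun x y hy => ?_⟩
    obtain ⟨hf1, hf2⟩ := hfM x y hy
    obtain ⟨hn1, hn2⟩ := hfn x y hy
    have hnb : |n (x, y)| ≤ M + 1 := by
      rw [abs_le] at *; constructor <;> linarith
    have hnb' : ‖fderivSnd n (x, y)‖ ≤ M + 1 := by
      have := norm_sub_norm_le (fderivSnd n (x, y)) (fderivSnd f (x, y))
      rw [norm_sub_rev] at this
      linarith
    obtain ⟨h1, h2⟩ := hcd _ hnb
    constructor
    · have e : f (x, y) ^ 2 - c * geluEven (d * n (x, y)) =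
          (f (x, y) - n (x, y)) * (f (x, y) + n (x, y)) +
            (n (x, y) ^ 2 - c * geluEven (d * n (x, y))) := by ring
      rw [e]
      refine (abs_add_le _ _).trans ?_
      rw [abs_mul]
      calc _ ≤ η * (M + (M + 1)) + η := by
            gcongr
            exact (abs_add_le _ _).trans (add_le_add hf1 hnb)
        _ ≤ ε := by nlinarith
    · rw [hder hf.contDiff, fderivSnd_smul (f := fun z => geluEven (d * n z))
        ((hn.smul d).geluEven).contDiff, fderivSnd_comp (hn.smul d).contDiff
        differentiable_geluEven, fderivSnd_smul hn.contDiff]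
      have e : (2 * f (x, y)) • fderivSnd f (x, y) - c • deriv geluEven (d * n (x, y)) • d •
          fderivSnd n (x, y) = (2 * f (x, y)) • (fderivSnd f (x, y) - fderivSnd n (x, y)) +
          (2 * (f (x, y) - n (x, y))) • fderivSnd n (x, y) +
          (2 * n (x, y) - c * (d * deriv geluEven (d * n (x, y)))) • fderivSnd n (x, y) := by
        module
      rw [e]
      refine (norm_add₃_le).trans ?_
      simp only [norm_smul, norm_mul, Real.norm_eq_abs, abs_two]
      calc _ ≤ 2 * M * η + 2 * η * (M + 1) + η * (M + 1) := by gcongr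
        _ ≤ ε := by nlinarith

/-- Polarization: `4 f g = (f + g)² - (f - g)²`. -/
lemma NetApprox.mul (hf : NetApprox K f) (hg : NetApprox K g) :
    NetApprox K fun z => f z * g z := by
  convert ((hf.add hg).sq.smul (1 / 4)).add ((hf.add (hg.smul (-1))).sq.smul (-(1 / 4))) using 2
  ring

lemma NetApprox.prod {ι : Type*} (s : Finset ι) (F : ι → Euc dx × Euc dy → ℝ)
    (hF : ∀ i ∈ s, NetApprox K (F i)) : NetApprox K fun z => ∏ i ∈ s, F i z := by
  classical
  induction s using Finset.induction_on with
  | empty => simpa using netApprox_const 1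
  | insert i s hi ih =>
    simp only [Finset.prod_insert hi]
    exact (hF i (Finset.mem_insert_self i s)).mul
      (ih fun j hj => hF j (Finset.mem_insert_of_mem hj))

lemma exists_abs_geluBump_le_const : ∃ C, 0 < C ∧ ∀ t, |geluBump t| ≤ C := by
  obtain ⟨C, hC, h⟩ := exists_abs_geluBump_le
  refine ⟨C, hC, fun t => (h t).trans ?_⟩
  have : (1 + |t|)⁻¹ ≤ 1 := inv_le_one_of_one_le₀ (by linarith [abs_nonneg t])
  nlinarith

/-- A bump on `ℝ^d`: the product over the coordinates of squared one-dimensional bumps. -/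
noncomputable def prodBump {d : ℕ} (z : Euc d) : ℝ := ∏ i, geluBump (z i) ^ 2

/-- Each factor is a network bounded on the whole line and constant in `y`, so the bounds hold for
every `x` without compactness. -/
lemma netApprox_prodBump_fst (c : ℝ) (a : Euc dx) :
    NetApprox K fun z : Euc dx × Euc dy => prodBump (c • (z.1 - a)) := by
  obtain ⟨C, hC, h⟩ := exists_abs_geluBump_le_const
  refine NetApprox.prod _ _ fun i _ => NetApprox.sq ?_
  have hnet := (((IsGeluNet.fst (dy := dy) i).add (.const (-a i))).smul c).geluBump
  simp only [← sub_eq_add_neg] at hnet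
  refine hnet.netApprox ⟨C, hC, fun x y _ => ⟨h _, ?_⟩⟩
  have := fderivSnd_fst (fun x : Euc dx => geluBump (c * (x i - a i))) (x, y)
  rw [this, norm_zero]
  exact hC.le

lemma netApprox_prodBump_snd (hK : IsCompact K) (c : ℝ) (b : Euc dy) :
    NetApprox K fun z : Euc dx × Euc dy => prodBump (c • (z.2 - b)) := by
  refine NetApprox.prod _ _ fun i _ => NetApprox.sq ?_
  have hnet := (((IsGeluNet.snd (dx := dx) i).add (.const (-b i))).smul c).geluBump
  simp only [← sub_eq_add_neg] at hnet
  have hc := hnet.contDiff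
  obtain ⟨M, hM⟩ := hK.exists_bound_of_continuousOn (f := fun y => geluBump (c * (y i - b i)))
    (hc.continuous.comp (Continuous.prodMk_right (0 : Euc dx))).continuousOn
  obtain ⟨M', hM'⟩ := hK.exists_bound_of_continuousOn
    (hc.continuous_fderivSnd.comp (Continuous.prodMk_right (0 : Euc dx))).continuousOn
  refine hnet.netApprox ⟨max 1 (max M M'), by positivity, fun x y hy => ⟨?_, ?_⟩⟩
  · exact (hM y hy).trans ((le_max_left _ _).trans (le_max_right _ _))
  · exact (hM' y hy).trans ((le_max_right _ _).trans (le_max_right _ _))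

end NetApprox

/-! ### Decay of the product bump at infinity -/

section BumpDecay

variable {d : ℕ}

lemma one_add_sum_le_prod_one_add {ι : Type*} (s : Finset ι) {f : ι → ℝ} (hf : ∀ i, 0 ≤ f i) :
    1 + ∑ i ∈ s, f i ≤ ∏ i ∈ s, (1 + f i) := by
  classical
  induction s using Finset.induction_on with
  | empty => simp
  | insert i s hi ih =>
    rw [Finset.sum_insert hi, Finset.prod_insert hi]
    nlinarith [hf i, Finset.sum_nonneg fun i (_ : i ∈ s) => hf i]

lemma contDiff_prodBump : ContDiff ℝ 1 (prodBump (d := d)) :=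
  contDiff_prod fun i _ => (contDiff_geluBump.comp (by fun_prop)).pow 2

lemma prodBump_nonneg (z : Euc d) : 0 ≤ prodBump z := Finset.prod_nonneg fun _ _ => sq_nonneg _

lemma prodBump_zero_pos : 0 < prodBump (0 : Euc d) :=
  Finset.prod_pos fun _ _ => pow_pos geluBump_zero_pos 2

/-- Of the two decaying factors in each squared bump one is bounded by `1`; the product of the
others is controlled by `∏ (1 + |z i|) ≥ 1 + ∑ |z i| ≥ 1 + ‖z‖`. -/
lemma tendsto_prodBump_cocompact : Tendsto (prodBump (d := d)) (cocompact _) (𝓝 0) := by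
  obtain ⟨C, hC, h⟩ := exists_abs_geluBump_le
  have hsum : ∀ z : Euc d, ‖z‖ ≤ ∑ i, |z i| := fun z => by
    rw [EuclideanSpace.norm_eq]
    refine Real.sqrt_le_iff.2 ⟨Finset.sum_nonneg fun _ _ => abs_nonneg _, ?_⟩
    simpa using Finset.sum_sq_le_sq_sum_of_nonneg (s := Finset.univ) (f := fun i => |z i|)
      fun _ _ => abs_nonneg _
  have hb : ∀ z : Euc d, prodBump z ≤ (C ^ 2) ^ d * (1 + ‖z‖)⁻¹ := fun z => by
    have h1 : 1 + ‖z‖ ≤ ∏ i, (1 + |z i|) :=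
      (add_le_add_right (hsum z) 1).trans
        (one_add_sum_le_prod_one_add _ fun i => abs_nonneg (z i))
    calc prodBump z ≤ ∏ i, (C ^ 2 * (1 + |z i|)⁻¹) := by
          refine Finset.prod_le_prod (fun _ _ => sq_nonneg _) fun i _ => ?_
          have h2 : (1 + |z i|)⁻¹ ≤ 1 := inv_le_one_of_one_le₀ (by linarith [abs_nonneg (z i)])
          have h3 : 0 ≤ (1 + |z i|)⁻¹ := by positivity
          rw [← sq_abs]
          calc |geluBump (z i)| ^ 2 ≤ (C * (1 + |z i|)⁻¹) ^ 2 := by gcongr; exact h _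
            _ = C ^ 2 * ((1 + |z i|)⁻¹ * (1 + |z i|)⁻¹) := by ring
            _ ≤ C ^ 2 * ((1 + |z i|)⁻¹ * 1) := by gcongr
            _ = _ := by rw [mul_one]
      _ = (C ^ 2) ^ d * (∏ i, (1 + |z i|))⁻¹ := by
          rw [Finset.prod_mul_distrib, Finset.prod_inv_distrib]; simp
      _ ≤ _ := by gcongr
  refine squeeze_zero prodBump_nonneg hb ?_
  have h1 : Tendsto (fun z : Euc d => 1 + ‖z‖) (cocompact _) atTop :=
    tendsto_atTop_add_const_left _ _ tendsto_norm_cocompact_atTop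
  simpa using (tendsto_inv_atTop_zero.comp h1).const_mul ((C ^ 2) ^ d)

end BumpDecay

/-! ### Density in `L^p` by Stone–Weierstrass -/

section Density

variable {dx dy : ℕ}

lemma tendsto_prodBump_smul_sub {c : ℝ} (hc : c ≠ 0) (a : Euc dx) :
    Tendsto (fun x => prodBump (c • (x - a))) (coclosedCompact _) (𝓝 0) := by
  rw [coclosedCompact_eq_cocompact]
  exact tendsto_prodBump_cocompact.comp
    ((Homeomorph.smulOfNeZero c hc).isClosedEmbedding.tendsto_cocompact.comp
      (Homeomorph.subRight a).isClosedEmbedding.tendsto_cocompact)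

/-- The continuous functions on the one-point compactification whose restrictions, as functions of
the first variable, are uniform limits of networks. -/
def netSubalgebra (dx : ℕ) (K : Set (Euc dy)) : Subalgebra ℝ C(OnePoint (Euc dx), ℝ) where
  carrier := {F | NetApprox K fun z : Euc dx × Euc dy => F (z.1 : OnePoint (Euc dx))}
  mul_mem' hf hg := hf.mul hg
  add_mem' hf hg := hf.add hg
  algebraMap_mem' c := netApprox_const c

/-- The function `x ↦ prodBump (c • (x - a))` on the one-point compactification. -/
noncomputable def onePointBump {c : ℝ} (hc : c ≠ 0) (a : Euc dx) : C(OnePoint (Euc dx), ℝ) :=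
  OnePoint.continuousMapMk ⟨fun x => prodBump (c • (x - a)),
    contDiff_prodBump.continuous.comp (by fun_prop)⟩ 0 (tendsto_prodBump_smul_sub hc a)

lemma onePointBump_coe {c : ℝ} (hc : c ≠ 0) (a x : Euc dx) :
    onePointBump hc a (x : OnePoint (Euc dx)) = prodBump (c • (x - a)) := rfl

lemma onePointBump_infty {c : ℝ} (hc : c ≠ 0) (a : Euc dx) :
    onePointBump hc a OnePoint.infty = 0 := rfl

lemma onePointBump_mem {c : ℝ} (hc : c ≠ 0) (a : Euc dx) (K : Set (Euc dy)) :
    onePointBump hc a ∈ netSubalgebra dx K :=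
  netApprox_prodBump_fst c a

/-- A bump centred at `a` separates `a` from infinity, and from `b` once it is narrow enough. -/
lemma netSubalgebra_separatesPoints (K : Set (Euc dy)) :
    (netSubalgebra dx K).SeparatesPoints := by
  have hinf : ∀ a : Euc dx, ∃ F ∈ netSubalgebra dx K, F a ≠ F OnePoint.infty := fun a =>
    ⟨_, onePointBump_mem one_ne_zero a K, by
      rw [onePointBump_coe, onePointBump_infty]; simpa using prodBump_zero_pos.ne'⟩
  have hfin : ∀ a b : Euc dx, a ≠ b → ∃ F ∈ netSubalgebra dx K, F a ≠ F b := fun a b hab => by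
    have hba : 0 < ‖b - a‖ := norm_pos_iff.2 (sub_ne_zero.2 hab.symm)
    have h1 : Tendsto (fun n : ℕ => ((n : ℝ) + 1) • (b - a)) atTop (cocompact _) := by
      rw [← Metric.cobounded_eq_cocompact, ← tendsto_norm_atTop_iff_cobounded]
      simp only [norm_smul]
      refine Tendsto.atTop_mul_const hba ?_
      refine tendsto_atTop_mono (fun n => ?_) tendsto_natCast_atTop_atTop
      exact (le_abs_self _).trans' (by linarith)
    obtain ⟨n, hn⟩ := ((tendsto_prodBump_cocompact.comp h1).eventually_lt_const
      prodBump_zero_pos).exists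
    have hc : (n : ℝ) + 1 ≠ 0 := by positivity
    refine ⟨_, onePointBump_mem hc a K, ?_⟩
    rw [onePointBump_coe, onePointBump_coe, sub_self, smul_zero]
    exact hn.ne'
  intro u v huv
  have key : ∃ F ∈ netSubalgebra dx K, F u ≠ F v := by
    induction u using OnePoint.rec with
    | infty =>
      induction v using OnePoint.rec with
      | infty => exact absurd rfl huv
      | coe b => obtain ⟨F, h1, h2⟩ := hinf b; exact ⟨F, h1, h2.symm⟩
    | coe a =>
      induction v using OnePoint.rec with
      | infty => exact hinf a
      | coe b => exact hfin a b fun h => huv (congrArg _ h)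
  obtain ⟨F, hF, h⟩ := key
  exact ⟨F, ⟨F, hF, rfl⟩, h⟩

lemma eLpNorm_le_ofReal_of_bound {α F : Type*} [MeasurableSpace α] [NormedAddCommGroup F]
    (μ : Measure α) [IsProbabilityMeasure μ] (p : ℝ≥0∞) {f : α → F} {C : ℝ}
    (h : ∀ x, ‖f x‖ ≤ C) : eLpNorm f p μ ≤ ENNReal.ofReal C := by
  simpa using eLpNorm_le_of_ae_bound (p := p) (μ := μ) (ae_of_all _ h)

/-- Bounded uniform limits of networks in the first variable are dense in `L^p`. -/
lemma exists_netApprox_eLpNorm_sub_le (μ : Measure (Euc dx)) [IsProbabilityMeasure μ] {p : ℝ≥0∞}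
    (hp1 : 1 ≤ p) (hp : p ≠ ∞) (K : Set (Euc dy)) {a : Euc dx → ℝ} (ha : MemLp a p μ) {ε : ℝ}
    (hε : 0 < ε) : ∃ b : Euc dx → ℝ, NetApprox K (fun z : Euc dx × Euc dy => b z.1) ∧
      Continuous b ∧ eLpNorm (a - b) p μ ≤ ENNReal.ofReal ε := by
  obtain ⟨g, hgc, hag, hg, hgL⟩ := ha.exists_hasCompactSupport_eLpNorm_sub_le hp
    (ε := ENNReal.ofReal (ε / 2)) (by simpa using hε)
  obtain ⟨⟨F, hF⟩, hFg⟩ := ContinuousMap.exists_mem_subalgebra_near_continuousMap_of_separatesPoints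
    (netSubalgebra dx K) (netSubalgebra_separatesPoints K)
    (OnePoint.continuousMapMk ⟨g, hg⟩ 0
      (by rw [coclosedCompact_eq_cocompact]; exact hgc.is_zero_at_infty))
    (ε / 2) (half_pos hε)
  have hFc : Continuous fun x : Euc dx => F x := F.continuous.comp OnePoint.continuous_coe
  refine ⟨fun x => F x, hF, hFc, ?_⟩
  have h1 : eLpNorm (g - fun x : Euc dx => F x) p μ ≤ ENNReal.ofReal (ε / 2) := by
    refine eLpNorm_le_ofReal_of_bound μ p fun x => ?_
    rw [Pi.sub_apply, norm_sub_rev]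
    exact (ContinuousMap.norm_coe_le_norm _ (x : OnePoint (Euc dx))).trans hFg.le
  calc eLpNorm (a - fun x : Euc dx => F x) p μ
      = eLpNorm ((a - g) + (g - fun x : Euc dx => F x)) p μ := by rw [sub_add_sub_cancel]
    _ ≤ eLpNorm (a - g) p μ + eLpNorm (g - fun x : Euc dx => F x) p μ :=
      eLpNorm_add_le (ha.1.sub hg.aestronglyMeasurable)
        (hg.sub hFc).aestronglyMeasurable hp1
    _ ≤ ENNReal.ofReal (ε / 2) + ENNReal.ofReal (ε / 2) := add_le_add hag h1
    _ = ENNReal.ofReal ε := by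
      rw [← ENNReal.ofReal_add (by positivity) (by positivity), add_halves]

end Density

/-! ### Integrals of bumps and integrals in closed subspaces -/

lemma integrable_prodBump {d : ℕ} : Integrable (prodBump (d := d)) := by
  have h : Integrable fun z : Fin d → ℝ => ∏ i, geluBump (z i) ^ 2 :=
    Integrable.fintype_prod (f := fun _ t => geluBump t ^ 2) fun _ => integrable_geluBump_sq
  exact ((EuclideanSpace.volume_preserving_symm_measurableEquiv_toLp (Fin d)).integrable_comp_emb
    (MeasurableEquiv.measurableEmbedding _)).2 h

lemma integral_prodBump_pos {d : ℕ} : 0 < ∫ z, prodBump (d := d) z :=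
  integral_pos_of_integrable_nonneg_nonzero (x := 0) contDiff_prodBump.continuous
    integrable_prodBump prodBump_nonneg prodBump_zero_pos.ne'

/-- A closed subspace is complete, so the integral can be formed inside it, and the inclusion
commutes with integration. -/
lemma Submodule.integral_mem_of_continuous {Z W : Type*} [TopologicalSpace Z] [MeasurableSpace Z]
    [OpensMeasurableSpace Z] [SecondCountableTopology Z] [T2Space Z] (ν : Measure Z)
    [IsFiniteMeasureOnCompacts ν] [NormedAddCommGroup W] [NormedSpace ℝ W] [CompleteSpace W]
    (S : Submodule ℝ W) (hS : IsClosed (S : Set W)) {f : Z → W} (hf : Continuous f)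
    (hfc : HasCompactSupport f) (hfS : ∀ z, f z ∈ S) : ∫ z, f z ∂ν ∈ S := by
  have : CompleteSpace S := hS.completeSpace_coe
  let f' : Z → S := fun z => ⟨f z, hfS z⟩
  have h1 : Continuous f' := hf.subtype_mk _
  have h2 : HasCompactSupport f' := HasCompactSupport.intro hfc fun z hz =>
    Subtype.ext (image_eq_zero_of_notMem_tsupport (f := f) hz)
  have h3 := S.subtypeL.integral_comp_comm (h1.integrable_of_hasCompactSupport h2 (μ := ν))
  have h4 : ∫ z, f z ∂ν = S.subtypeL (∫ z, f' z ∂ν) := h3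
  rw [h4]
  exact Subtype.prop _

/-! ### First-order jets -/

section Jet

variable {d : ℕ}

/-- The value and the partial derivatives of `k` at `y`. -/
noncomputable def jet (k : Euc d → ℝ) (y : Euc d) : Option (Fin d) → ℝ
  | none => k y
  | some j => fderiv ℝ k y (EuclideanSpace.single j 1)

lemma continuous_jet {k : Euc d → ℝ} (hk : ContDiff ℝ 1 k) (i : Option (Fin d)) :
    Continuous fun y => jet k y i := by
  cases i with
  | none => exact hk.continuous
  | some j => exact (hk.continuous_fderiv one_ne_zero).clm_apply continuous_const

lemma jet_comp_sub {k : Euc d → ℝ} (z y : Euc d) (i : Option (Fin d)) :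
    jet (fun y => k (y - z)) y i = jet k (y - z) i := by
  cases i with
  | none => rfl
  | some j => simp only [jet, fderiv_comp_sub]

lemma jet_add {k l : Euc d → ℝ} {y : Euc d} (hk : DifferentiableAt ℝ k y)
    (hl : DifferentiableAt ℝ l y) (i : Option (Fin d)) :
    jet (fun y => k y + l y) y i = jet k y i + jet l y i := by
  cases i with
  | none => rfl
  | some j => simp [jet, fderiv_fun_add hk hl]

lemma jet_smul {k : Euc d → ℝ} {y : Euc d} (hk : DifferentiableAt ℝ k y) (c : ℝ)
    (i : Option (Fin d)) : jet (fun y => c * k y) y i = c * jet k y i := by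
  cases i with
  | none => rfl
  | some j => simp [jet, fderiv_const_mul hk]

lemma abs_jet_sub_le {k l : Euc d → ℝ} {y : Euc d} {ε : ℝ} (h0 : |k y - l y| ≤ ε)
    (h1 : ‖fderiv ℝ k y - fderiv ℝ l y‖ ≤ ε) (i : Option (Fin d)) :
    |jet k y i - jet l y i| ≤ ε := by
  cases i with
  | none => exact h0
  | some j =>
    have := (fderiv ℝ k y - fderiv ℝ l y).le_opNorm (EuclideanSpace.single j 1)
    simp only [PiLp.norm_single, norm_one, mul_one] at this
    exact this.trans h1

lemma continuous_jet_fst {dx : ℕ} {f : Euc dx × Euc d → ℝ} (hf : ContDiff ℝ 1 f) (y : Euc d)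
    (i : Option (Fin d)) : Continuous fun x => jet (fun y => f (x, y)) y i := by
  cases i with
  | none => exact hf.continuous.comp (Continuous.prodMk_left y)
  | some j =>
    exact (hf.continuous_fderivSnd.comp (Continuous.prodMk_left y)).clm_apply continuous_const

lemma ContDiff.differentiableAt_snd {dx : ℕ} {f : Euc dx × Euc d → ℝ} (hf : ContDiff ℝ 1 f)
    (x : Euc dx) (y : Euc d) : DifferentiableAt ℝ (fun y => f (x, y)) y :=
  (hf.hasFDerivAt_fderivSnd (x, y)).differentiableAt

end Jet

/-! ### Jets approximable by networks -/

section NetSubmodule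

variable {dx dy : ℕ} (μ : Measure (Euc dx)) (p : ℝ≥0∞) [Fact (1 ≤ p)]
  (K : Set (Euc dy))

/-- The continuous families over `K` of jets with values in `L^p` that are uniform limits of jets
of GELU networks. -/
def netSubmodule : Submodule ℝ C(K, Option (Fin dy) → Lp ℝ p μ) where
  carrier := {F | ∀ ε > 0, ∃ n : Euc dx × Euc dy → ℝ, IsGeluNet netInput n ∧ ∀ (y : K) i,
    eLpNorm (fun x => F y i x - jet (fun y => n (x, y)) y i) p μ ≤ ENNReal.ofReal ε}
  zero_mem' ε hε := by
    refine ⟨_, .const 0, fun y i => ?_⟩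
    have h : (fun x => (0 : Lp ℝ p μ) x - jet (fun _ => (0 : ℝ)) (y : Euc dy) i) =ᵐ[μ] 0 := by
      filter_upwards [Lp.coeFn_zero ℝ p μ] with x hx
      rw [hx]
      cases i <;> simp [jet]
    exact (eLpNorm_congr_ae h).trans_le (by simp)
  add_mem' {F G} hF hG ε hε := by
    obtain ⟨n, hn, h1⟩ := hF (ε / 2) (half_pos hε)
    obtain ⟨m, hm, h2⟩ := hG (ε / 2) (half_pos hε)
    refine ⟨_, hn.add hm, fun y i => ?_⟩
    have h : (fun x => (F y i + G y i) x - jet (fun y => n (x, y) + m (x, y)) y i) =ᵐ[μ]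
        (fun x => F y i x - jet (fun y => n (x, y)) y i) +
          fun x => G y i x - jet (fun y => m (x, y)) y i := by
      filter_upwards [Lp.coeFn_add (F y i) (G y i)] with x hx
      rw [hx, jet_add (hn.contDiff.differentiableAt_snd _ _) (hm.contDiff.differentiableAt_snd _ _)]
      simp only [Pi.add_apply]
      ring
    refine (eLpNorm_congr_ae h).trans_le ?_
    rw [← add_halves ε, ENNReal.ofReal_add (by positivity) (by positivity)]
    refine (eLpNorm_add_le ?_ ?_ Fact.out).trans (add_le_add (h1 y i) (h2 y i))
    · exact (Lp.aestronglyMeasurable _).sub (continuous_jet_fst hn.contDiff _ _).aestronglyMeasurable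
    · exact (Lp.aestronglyMeasurable _).sub (continuous_jet_fst hm.contDiff _ _).aestronglyMeasurable
  smul_mem' c F hF ε hε := by
    obtain ⟨n, hn, h1⟩ := hF (ε / (|c| + 1)) (by positivity)
    refine ⟨_, hn.smul c, fun y i => ?_⟩
    have h : (fun x => (c • F y i) x - jet (fun y => c * n (x, y)) y i) =ᵐ[μ]
        c • fun x => F y i x - jet (fun y => n (x, y)) y i := by
      filter_upwards [Lp.coeFn_smul c (F y i)] with x hx
      rw [hx, jet_smul (hn.contDiff.differentiableAt_snd _ _)]
      simp only [Pi.smul_apply, smul_eq_mul]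
      ring
    refine (eLpNorm_congr_ae h).trans_le ?_
    rw [eLpNorm_const_smul, Real.enorm_eq_ofReal_abs]
    calc _ ≤ ENNReal.ofReal |c| * ENNReal.ofReal (ε / (|c| + 1)) := by gcongr; exact h1 y i
      _ = ENNReal.ofReal (|c| * (ε / (|c| + 1))) := by rw [ENNReal.ofReal_mul (abs_nonneg c)]
      _ ≤ ENNReal.ofReal ((|c| + 1) * (ε / (|c| + 1))) := by gcongr; linarith
      _ = ENNReal.ofReal ε := by congr 1; field_simp

variable {μ p K}

lemma mem_netSubmodule {F : C(K, Option (Fin dy) → Lp ℝ p μ)} :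
    F ∈ netSubmodule μ p K ↔ ∀ ε > 0, ∃ n : Euc dx × Euc dy → ℝ, IsGeluNet netInput n ∧
      ∀ (y : K) i, eLpNorm (fun x => F y i x - jet (fun y => n (x, y)) y i) p μ ≤
        ENNReal.ofReal ε := Iff.rfl

/-- The norm of `C(K, Option (Fin dy) → Lp ℝ p μ)` dominates the `L^p` norm at every `y` and every
index, so an `ε / 2` argument applies. -/
lemma isClosed_netSubmodule [CompactSpace K] :
    IsClosed (netSubmodule μ p K : Set C(K, Option (Fin dy) → Lp ℝ p μ)) := by
  refine isClosed_of_closure_subset fun F hF => ?_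
  rw [SetLike.mem_coe, mem_netSubmodule]
  intro ε hε
  obtain ⟨G, hG, hFG⟩ := Metric.mem_closure_iff.1 hF (ε / 2) (half_pos hε)
  obtain ⟨n, hn, h1⟩ := hG (ε / 2) (half_pos hε)
  refine ⟨n, hn, fun y i => ?_⟩
  have h : (fun x => F y i x - jet (fun y => n (x, y)) y i) =ᵐ[μ]
      ⇑(F y i - G y i) + fun x => G y i x - jet (fun y => n (x, y)) y i := by
    filter_upwards [Lp.coeFn_sub (F y i) (G y i)] with x hx
    simp only [Pi.add_apply, hx, Pi.sub_apply]
    ring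
  refine (eLpNorm_congr_ae h).trans_le ?_
  rw [← add_halves ε, ENNReal.ofReal_add (by positivity) (by positivity)]
  refine (eLpNorm_add_le (Lp.aestronglyMeasurable _) ?_ Fact.out).trans
    (add_le_add ?_ (h1 y i))
  · exact (Lp.aestronglyMeasurable _).sub (continuous_jet_fst hn.contDiff _ _).aestronglyMeasurable
  · rw [← Lp.enorm_def, ← ofReal_norm]
    refine ENNReal.ofReal_le_ofReal (le_trans ?_ hFG.le)
    rw [dist_eq_norm]
    exact (norm_le_pi_norm (F y - G y) i).trans ((F - G).norm_coe_le_norm y)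

/-- Replace `a` by a bounded uniform limit `b` of networks, at a cost controlled by the bound `M` on
the jet of `k`. The product `b(x) k(y)` is again such a limit, and its jet in `y` is `b` times the
jet of `k`. -/
lemma mem_netSubmodule_of_eq_smul [IsProbabilityMeasure μ] (hp : p ≠ ∞) {k : Euc dy → ℝ}
    (hk : NetApprox K fun z : Euc dx × Euc dy => k z.2) (a : Lp ℝ p μ)
    {F : C(K, Option (Fin dy) → Lp ℝ p μ)} (hF : ∀ y i, F y i = jet k y i • a) :
    F ∈ netSubmodule μ p K := by
  rw [mem_netSubmodule]
  intro ε hε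
  obtain ⟨M, hM, hkM⟩ := hk.bounded
  have hjet : ∀ (y : K) i, |jet k y i| ≤ M := fun y i => by
    have h := hkM 0 y y.2
    have := abs_jet_sub_le (k := k) (l := fun _ => 0) (y := y) (ε := M) (by simpa using h.1)
      (by simpa using (show ‖fderiv ℝ k y‖ ≤ M from h.2)) i
    cases i <;> simpa [jet] using this
  obtain ⟨b, hb, hbc, hab⟩ := exists_netApprox_eLpNorm_sub_le μ (Fact.out : 1 ≤ p) hp K
    (Lp.memLp a) (show 0 < ε / (2 * M) by positivity)
  obtain ⟨n, hn, hbn⟩ := (hb.mul hk).approx (ε / 2) (half_pos hε)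
  refine ⟨n, hn, fun y i => ?_⟩
  have hkd : DifferentiableAt ℝ k y := hk.contDiff.differentiableAt_snd 0 y
  have h : (fun x => F y i x - jet (fun y => n (x, y)) y i) =ᵐ[μ]
      (jet k y i • (⇑a - b)) + fun x => b x * jet k y i - jet (fun y => n (x, y)) y i := by
    rw [hF]
    filter_upwards [Lp.coeFn_smul (jet k y i) a] with x hx
    simp only [hx, Pi.add_apply, Pi.smul_apply, Pi.sub_apply, smul_eq_mul]
    ring
  refine (eLpNorm_congr_ae h).trans_le ?_
  rw [← add_halves ε, ENNReal.ofReal_add (by positivity) (by positivity)]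
  refine (eLpNorm_add_le ?_ ?_ Fact.out).trans (add_le_add ?_ ?_)
  · exact ((Lp.aestronglyMeasurable _).sub hbc.aestronglyMeasurable).const_smul _
  · exact ((hbc.mul continuous_const).sub
      (continuous_jet_fst hn.contDiff _ _)).aestronglyMeasurable
  · rw [eLpNorm_const_smul, Real.enorm_eq_ofReal_abs]
    calc _ ≤ ENNReal.ofReal M * ENNReal.ofReal (ε / (2 * M)) := by
          gcongr
          exact hjet y i
      _ = ENNReal.ofReal (ε / 2) := by
          rw [← ENNReal.ofReal_mul hM.le]; congr 1; field_simp
  · refine eLpNorm_le_ofReal_of_bound μ p fun x => ?_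
    rw [← jet_smul hkd]
    have := hbn x y y.2
    exact abs_jet_sub_le this.1 this.2 i

end NetSubmodule

/-! ### Smoothing in the second variable -/

section Smoothing

variable {dx dy : ℕ} {μ : Measure (Euc dx)} [IsProbabilityMeasure μ] {p : ℝ≥0∞} [Fact (1 ≤ p)]
  {K : Set (Euc dy)}

/-- The restrictions to `K` of the reflected translates of `H`. -/
def translates {V : Type*} [TopologicalSpace V] (K : Set (Euc dy)) {H : Euc dy → V}
    (hH : Continuous H) : C(Euc dy, C(K, V)) :=
  ContinuousMap.curry ⟨fun zy : Euc dy × K => H (zy.2 - zy.1), hH.comp (by fun_prop)⟩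

lemma translates_apply {V : Type*} [TopologicalSpace V] {H : Euc dy → V} (hH : Continuous H)
    (z : Euc dy) (y : K) : translates K hH z y = H (y - z) := rfl

lemma hasCompactSupport_translates {V : Type*} [NormedAddCommGroup V] (hK : IsCompact K)
    {H : Euc dy → V} (hH : Continuous H) (hc : HasCompactSupport H) :
    HasCompactSupport (translates K hH) := by
  refine HasCompactSupport.intro
    ((hK.prod hc.isCompact).image (continuous_fst.sub continuous_snd)) fun z hz => ?_
  ext1 y
  rw [translates_apply]
  refine image_eq_zero_of_notMem_tsupport fun h => hz ?_
  exact ⟨(y, y - z), ⟨y.2, h⟩, by simp⟩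

/-- The functions `y ↦ k (y - z) • H z`, together with their partial derivatives. -/
noncomputable def kernelJets {E : Type*} [NormedAddCommGroup E] [NormedSpace ℝ E]
    (K : Set (Euc dy)) {k : Euc dy → ℝ} (hk : ContDiff ℝ 1 k) {H : Euc dy → E}
    (hH : Continuous H) : C(Euc dy, C(K, Option (Fin dy) → E)) :=
  ContinuousMap.curry ⟨fun zy : Euc dy × K => fun i => jet k (zy.2 - zy.1) i • H zy.1,
    continuous_pi fun i => ((continuous_jet hk i).comp (by fun_prop)).smul
      (hH.comp continuous_fst)⟩

lemma kernelJets_apply {E : Type*} [NormedAddCommGroup E] [NormedSpace ℝ E]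
    {k : Euc dy → ℝ} (hk : ContDiff ℝ 1 k) {H : Euc dy → E} (hH : Continuous H)
    (z : Euc dy) (y : K) (i : Option (Fin dy)) :
    kernelJets K hk hH z y i = jet k (y - z) i • H z := rfl

lemma hasCompactSupport_kernelJets {E : Type*} [NormedAddCommGroup E] [NormedSpace ℝ E]
    {k : Euc dy → ℝ} (hk : ContDiff ℝ 1 k) {H : Euc dy → E} (hH : Continuous H)
    (hc : HasCompactSupport H) : HasCompactSupport (kernelJets K hk hH) := by
  refine HasCompactSupport.intro hc fun z hz => ?_
  ext1 y
  funext i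
  rw [kernelJets_apply, image_eq_zero_of_notMem_tsupport hz, smul_zero]
  rfl

/-- Evaluation of a continuous family at a point and an index. -/
noncomputable def evalAt {E : Type*} [NormedAddCommGroup E] [NormedSpace ℝ E] [CompactSpace K]
    (y : K) (i : Option (Fin dy)) : C(K, Option (Fin dy) → E) →L[ℝ] E :=
  (ContinuousLinearMap.proj i).comp (ContinuousMap.evalCLM ℝ y)

/-- Differentiating a convolution may be done on either factor. -/
lemma integral_kernelJets {E : Type*} [NormedAddCommGroup E] [NormedSpace ℝ E] [CompleteSpace E]
    [CompactSpace K] (hK : IsCompact K) {k : Euc dy → ℝ} (hk : ContDiff ℝ 1 k)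
    {H : Euc dy → Option (Fin dy) → E} (hH : Continuous H) (hc : HasCompactSupport H)
    (hd : ∀ z j, HasLineDerivAt ℝ (fun z => H z none) (H z (some j)) z
      (EuclideanSpace.single j 1)) :
    ∫ z, kernelJets K hk ((continuous_apply none).comp hH) z =
      ∫ z, k z • translates K hH z := by
  have hHi : ∀ i, Continuous fun z => H z i := fun i => (continuous_apply i).comp hH
  have hci : ∀ i, HasCompactSupport fun z => H z i := fun i =>
    hc.comp_left (g := fun v : Option (Fin dy) → E => v i) rfl
  have hi1 : Integrable (kernelJets K hk (hHi none)) :=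
    (kernelJets K hk (hHi none)).continuous.integrable_of_hasCompactSupport
      (hasCompactSupport_kernelJets hk _ (hci none))
  have hi2 : Integrable fun z => k z • translates K hH z :=
    (hk.continuous.smul (translates K hH).continuous).integrable_of_hasCompactSupport
      (hasCompactSupport_translates hK hH hc).smul_left
  have key : ∀ (y : K) i, ∫ z, jet k (y - z) i • H z none = ∫ z, k z • H (y - z) i := by
    intro y i
    have hsub : ∫ z, k z • H (y - z) i = ∫ z, k (y - z) • H z i := by
      rw [← integral_sub_left_eq_self _ _ (y : Euc dy)]
      simp
    rw [hsub]
    cases i with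
    | none => rfl
    | some j =>
      have hint : ∀ i i', Integrable fun z => jet k (y - z) i • H z i' := fun i i' =>
        (((continuous_jet hk i).comp (by fun_prop)).smul (hHi i')).integrable_of_hasCompactSupport
          (hci i').smul_left
      -- Integration by parts in direction `j`. Its sign cancels the sign from differentiating `k (y
      -- - z)` in `z`. Compact support of `H` alone makes the integrands integrable, so `k` may have
      -- full support.
      have := integral_bilinear_hasLineDerivAt_right_eq_neg_left_of_integrable
        (μ := (volume : Measure (Euc dy))) (B := ContinuousLinearMap.lsmul ℝ ℝ)
        (f := fun z => k (y - z)) (f' := fun z => -jet k (y - z) (some j))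
        (g := fun z => H z none) (g' := fun z => H z (some j)) (v := EuclideanSpace.single j 1)
        (by simpa using (hint (some j) none).neg) (hint none (some j)) (hint none none)
        (fun z _ => ?_) (fun z _ => hd z j)
      · simp only [ContinuousLinearMap.lsmul_apply, neg_smul, integral_neg, neg_neg] at this
        exact this.symm
      · have h1 : HasFDerivAt (fun z => k (y - z)) (-fderiv ℝ k (y - z)) z := by
          have := ((hk.differentiable one_ne_zero (y - z)).hasFDerivAt).comp z
            ((hasFDerivAt_id z).const_sub (y : Euc dy))
          refine this.congr_fderiv ?_
          ext; simp
        exact h1.hasLineDerivAt _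
  ext1 y
  funext i
  have e1 := (evalAt (E := E) y i).integral_comp_comm hi1
  have e2 := (evalAt (E := E) y i).integral_comp_comm hi2
  exact e1.symm.trans ((key y i).trans e2)

/-- Approximate identity in rescaled variables: dominated convergence, with `F` bounded and `k`
integrable. -/
lemma tendsto_integral_smul_rescale {W : Type*} [NormedAddCommGroup W] [NormedSpace ℝ W]
    [CompleteSpace W] {d : ℕ} {k : Euc d → ℝ} (hk : Continuous k) (hki : Integrable k)
    {F : Euc d → W} (hF : Continuous F) (hc : HasCompactSupport F) :
    Tendsto (fun n : ℕ => ∫ u, k u • F (((n : ℝ) + 1)⁻¹ • u)) atTop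
      (𝓝 ((∫ u, k u) • F 0)) := by
  obtain ⟨C, hC⟩ := hF.bounded_above_of_compact_support hc
  rw [← integral_smul_const]
  refine tendsto_integral_of_dominated_convergence (fun u => ‖k u‖ * C) (fun n => ?_)
    (hki.norm.mul_const C) (fun n => ae_of_all _ fun u => ?_) (ae_of_all _ fun u => ?_)
  · exact (hk.smul (hF.comp (by fun_prop))).aestronglyMeasurable
  · rw [norm_smul]
    gcongr
    exact hC _
  · have h1 : Tendsto (fun n : ℕ => ((n : ℝ) + 1)⁻¹ • u) atTop (𝓝 ((0 : ℝ) • u)) := by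
      refine Tendsto.smul_const ?_ u
      simpa using tendsto_one_div_add_atTop_nhds_zero_nat (𝕜 := ℝ)
    rw [zero_smul] at h1
    exact ((hF.tendsto 0).comp h1).const_smul _

/-- A compactly supported continuously differentiable function with values in `L^p` is together
with its partial derivatives a uniform limit of networks. -/
lemma mem_netSubmodule_of_hasLineDerivAt (hp : p ≠ ∞) (hK : IsCompact K)
    {H : Euc dy → Option (Fin dy) → Lp ℝ p μ} (hH : Continuous H) (hc : HasCompactSupport H)
    (hd : ∀ z j, HasLineDerivAt ℝ (fun z => H z none) (H z (some j)) z
      (EuclideanSpace.single j 1)) :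
    (⟨fun y : K => H y, by fun_prop⟩ : C(K, Option (Fin dy) → Lp ℝ p μ)) ∈
      netSubmodule μ p K := by
  have : CompactSpace K := isCompact_iff_compactSpace.1 hK
  set F := translates K hH with hFdef
  have h1 : ∀ n : ℕ, ∫ u, prodBump u • F (((n : ℝ) + 1)⁻¹ • u) ∈ netSubmodule μ p K := fun n => by
    have hn : (n : ℝ) + 1 ≠ 0 := by positivity
    have hk : ContDiff ℝ 1 fun z : Euc dy => prodBump (((n : ℝ) + 1) • z) :=
      contDiff_prodBump.comp (by fun_prop)
    -- The substitution `u = (n + 1) z` costs a positive Jacobian factor, which membership in a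
    -- subspace ignores. For the same reason the bump need not have integral `1`.
    have h2 := Measure.integral_comp_smul (volume : Measure (Euc dy))
      (fun u => prodBump u • F (((n : ℝ) + 1)⁻¹ • u)) ((n : ℝ) + 1)
    simp only [smul_smul, inv_mul_cancel₀ hn, one_smul] at h2
    rw [← integral_kernelJets hK hk hH hc hd] at h2
    have h3 : ∫ z, kernelJets K hk ((continuous_apply none).comp hH) z ∈ netSubmodule μ p K := by
      refine Submodule.integral_mem_of_continuous _ _ isClosed_netSubmodule
        (ContinuousMap.continuous _) (hasCompactSupport_kernelJets _ _
          (hc.comp_left (g := fun v : Option (Fin dy) → Lp ℝ p μ => v none) rfl)) fun z => ?_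
      refine mem_netSubmodule_of_eq_smul (k := fun y => prodBump (((n : ℝ) + 1) • (y - z))) hp
        (netApprox_prodBump_snd (dx := dx) hK ((n : ℝ) + 1) z) (H z none) fun y i => ?_
      rw [kernelJets_apply, ← jet_comp_sub]
      rfl
    rw [h2] at h3
    refine (Submodule.smul_mem_iff _ ?_).1 h3
    positivity
  have h2 := isClosed_netSubmodule.mem_of_tendsto
    (tendsto_integral_smul_rescale contDiff_prodBump.continuous integrable_prodBump
      F.continuous (hasCompactSupport_translates hK hH hc)) (Eventually.of_forall h1)
  have h3 := (Submodule.smul_mem_iff _ integral_prodBump_pos.ne').1 h2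
  convert h3 using 1
  ext1 y
  change H y = H (y - 0)
  rw [sub_zero]

end Smoothing

/-! ### Differentiation in `L^p` -/

lemma eLpNorm_le_iff_lintegral_rpow_le {α F : Type*} [MeasurableSpace α] [NormedAddCommGroup F]
    {μ : Measure α} {p : ℝ≥0∞} (hp1 : 1 ≤ p) (hp : p ≠ ∞) {f : α → F} {C : ℝ≥0∞} :
    eLpNorm f p μ ≤ C ↔ ∫⁻ x, ‖f x‖ₑ ^ p.toReal ∂μ ≤ C ^ p.toReal := by
  have hp0 : p ≠ 0 := (zero_lt_one.trans_le hp1).ne'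
  rw [eLpNorm_eq_lintegral_rpow_enorm_toReal hp0 hp, one_div,
    ENNReal.rpow_inv_le_iff (ENNReal.toReal_pos hp0 hp)]

/-- A weak form of Minkowski's inequality for integrals. -/
lemma eLpNorm_integral_le_of_forall {α β : Type*} [MeasurableSpace α] [MeasurableSpace β]
    (μ : Measure α) [SFinite μ] (ν : Measure β) [IsProbabilityMeasure ν] {p : ℝ≥0∞} (hp1 : 1 ≤ p)
    (hp : p ≠ ∞) {D : β → α → ℝ} (hD : Measurable (Function.uncurry D)) {C : ℝ≥0∞}
    (h : ∀ s, eLpNorm (D s) p μ ≤ C) : eLpNorm (fun x => ∫ s, D s x ∂ν) p μ ≤ C := by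
  -- Jensen's inequality in the form that the `L^1` norm is at most the `L^p` norm on a probability
  -- space; Tonelli then swaps the integrals.
  have hjensen : ∀ x, ‖∫ s, D s x ∂ν‖ₑ ^ p.toReal ≤ ∫⁻ s, ‖D s x‖ₑ ^ p.toReal ∂ν := fun x => by
    have hx : AEStronglyMeasurable (fun s => D s x) ν :=
      (hD.comp measurable_prodMk_right).aestronglyMeasurable
    have h1 : eLpNorm (fun s => D s x) p ν ^ p.toReal = ∫⁻ s, ‖D s x‖ₑ ^ p.toReal ∂ν := by
      have hp0 : p ≠ 0 := (zero_lt_one.trans_le hp1).ne'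
      rw [eLpNorm_eq_lintegral_rpow_enorm_toReal hp0 hp, one_div,
        ENNReal.rpow_inv_rpow (ENNReal.toReal_pos hp0 hp).ne']
    rw [← h1]
    gcongr
    calc ‖∫ s, D s x ∂ν‖ₑ ≤ ∫⁻ s, ‖D s x‖ₑ ∂ν := enorm_integral_le_lintegral_enorm _
      _ = eLpNorm (fun s => D s x) 1 ν := eLpNorm_one_eq_lintegral_enorm.symm
      _ ≤ eLpNorm (fun s => D s x) p ν := eLpNorm_le_eLpNorm_of_exponent_le hp1 hx
  rw [eLpNorm_le_iff_lintegral_rpow_le hp1 hp]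
  calc _ ≤ ∫⁻ x, ∫⁻ s, ‖D s x‖ₑ ^ p.toReal ∂ν ∂μ := lintegral_mono hjensen
    _ = ∫⁻ s, ∫⁻ x, ‖D s x‖ₑ ^ p.toReal ∂μ ∂ν := by
      refine lintegral_lintegral_swap ?_
      exact ((hD.comp measurable_swap).enorm.pow_const _).aemeasurable
    _ ≤ ∫⁻ _, C ^ p.toReal ∂ν :=
      lintegral_mono fun s => (eLpNorm_le_iff_lintegral_rpow_le hp1 hp).1 (h s)
    _ = C ^ p.toReal := by simp

/-- Pointwise, the first-order remainder is `h ∫₀¹ (φ'(t₀ + s h) - φ'(t₀)) ds`. Minkowski's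
inequality bounds its `L^p` norm by `|h|` times the oscillation of `u'` near `t₀`, which is small by
continuity. -/
lemma hasDerivAt_Lp {α : Type*} [TopologicalSpace α] [SecondCountableTopology α]
    [MeasurableSpace α] [OpensMeasurableSpace α] (μ : Measure α) [SFinite μ] {p : ℝ≥0∞}
    [Fact (1 ≤ p)] (hp : p ≠ ∞) {φ φ' : ℝ → α → ℝ} (hφ : ∀ t x, HasDerivAt (φ · x) (φ' t x) t)
    (hφ' : Continuous (Function.uncurry φ')) {u u' : ℝ → Lp ℝ p μ} (hu : ∀ t, u t =ᵐ[μ] φ t)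
    (hu' : ∀ t, u' t =ᵐ[μ] φ' t) {t₀ : ℝ} (hc : ContinuousAt u' t₀) :
    HasDerivAt u (u' t₀) t₀ := by
  have hp1 : 1 ≤ p := Fact.out
  rw [hasDerivAt_iff_isLittleO_nhds_zero, Asymptotics.isLittleO_iff]
  intro c hcpos
  obtain ⟨δ, hδ, h1⟩ := Metric.continuousAt_iff.1 hc c hcpos
  refine Metric.eventually_nhds_iff_ball.2 ⟨δ, hδ, fun h hh => ?_⟩
  have hh' : |h| < δ := by simpa using hh
  have hprob : IsProbabilityMeasure (volume.restrict (Set.Ioc (0 : ℝ) 1)) := ⟨by simp⟩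
  have hcont : Continuous (Function.uncurry fun s x => φ' (t₀ + s * h) x - φ' t₀ x) := by
    have e1 : Continuous fun z : ℝ × α => Function.uncurry φ' (t₀ + z.1 * h, z.2) :=
      hφ'.comp (by fun_prop)
    have e2 : Continuous fun z : ℝ × α => Function.uncurry φ' (t₀, z.2) := hφ'.comp (by fun_prop)
    exact e1.sub e2
  -- Clamping `s` to `[0, 1]` makes the bound hold for every real `s`, as the integral inequality
  -- requires; on the domain of integration nothing changes.
  set ρ : ℝ → ℝ := fun s => max 0 (min 1 s) with hρ
  have hρ01 : ∀ s, |ρ s| ≤ 1 := fun s => by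
    rw [abs_of_nonneg (le_max_left _ _)]
    exact max_le zero_le_one (min_le_left _ _)
  have hbound : ∀ s, eLpNorm (fun x => φ' (t₀ + ρ s * h) x - φ' t₀ x) p μ ≤
      ENNReal.ofReal c := fun s => by
    have e : (fun x => φ' (t₀ + ρ s * h) x - φ' t₀ x) =ᵐ[μ]
        ⇑(u' (t₀ + ρ s * h) - u' t₀) := by
      filter_upwards [hu' (t₀ + ρ s * h), hu' t₀, Lp.coeFn_sub (u' (t₀ + ρ s * h)) (u' t₀)]
        with x hx1 hx2 hx3
      rw [hx3, Pi.sub_apply, hx1, hx2]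
    rw [eLpNorm_congr_ae e, ← Lp.enorm_def, ← ofReal_norm, ← dist_eq_norm]
    refine ENNReal.ofReal_le_ofReal (h1 ?_).le
    rw [dist_eq_norm, add_sub_cancel_left, norm_mul, Real.norm_eq_abs, Real.norm_eq_abs]
    exact (mul_le_of_le_one_left (abs_nonneg h) (hρ01 s)).trans_lt hh'
  have hmink := eLpNorm_integral_le_of_forall μ (volume.restrict (Set.Ioc (0 : ℝ) 1)) hp1 hp
    (D := fun s x => φ' (t₀ + ρ s * h) x - φ' t₀ x)
    (hcont.comp (f := fun z : ℝ × α => (ρ z.1, z.2)) (by fun_prop)).measurable hbound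
  have hFTC : ∀ x, φ (t₀ + h) x - φ t₀ x - h * φ' t₀ x =
      h * ∫ s in Set.Ioc (0 : ℝ) 1, (φ' (t₀ + ρ s * h) x - φ' t₀ x) := fun x => by
    have e1 : ∫ s in Set.Ioc (0 : ℝ) 1, (φ' (t₀ + ρ s * h) x - φ' t₀ x) =
        ∫ s in (0 : ℝ)..1, (φ' (t₀ + s * h) x - φ' t₀ x) := by
      rw [intervalIntegral.integral_of_le zero_le_one]
      refine setIntegral_congr_fun measurableSet_Ioc fun s hs => ?_
      have : ρ s = s := by simp [hρ, hs.1.le, hs.2]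
      simp only [this]
    have e2 : ∀ s, HasDerivAt (fun s => φ (t₀ + s * h) x - s * (h * φ' t₀ x))
        (h * (φ' (t₀ + s * h) x - φ' t₀ x)) s := fun s => by
      have d1 : HasDerivAt (fun s : ℝ => t₀ + s * h) h s := by
        simpa using ((hasDerivAt_id s).mul_const h).const_add t₀
      have d2 := (hφ (t₀ + s * h) x).comp s d1
      have d3 := d2.sub ((hasDerivAt_id s).mul_const (h * φ' t₀ x))
      refine d3.congr_deriv ?_
      ring
    have e3 : Continuous fun s => h * (φ' (t₀ + s * h) x - φ' t₀ x) :=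
      continuous_const.mul (hcont.comp (Continuous.prodMk_left x))
    have e4 := intervalIntegral.integral_eq_sub_of_hasDerivAt (a := 0) (b := 1) (fun s _ => e2 s)
      (e3.intervalIntegrable _ _)
    rw [intervalIntegral.integral_const_mul] at e4
    rw [e1, e4]
    simp
    ring
  have hae : ⇑(u (t₀ + h) - u t₀ - h • u' t₀) =ᵐ[μ]
      h • fun x => ∫ s in Set.Ioc (0 : ℝ) 1, (φ' (t₀ + ρ s * h) x - φ' t₀ x) := by
    filter_upwards [Lp.coeFn_sub (u (t₀ + h) - u t₀) (h • u' t₀),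
      Lp.coeFn_sub (u (t₀ + h)) (u t₀), Lp.coeFn_smul h (u' t₀), hu (t₀ + h), hu t₀, hu' t₀]
      with x a1 a2 a3 a4 a5 a6
    rw [a1, Pi.sub_apply, a2, Pi.sub_apply, a3, Pi.smul_apply, a4, a5, a6, smul_eq_mul, hFTC,
      Pi.smul_apply, smul_eq_mul]
  rw [Lp.norm_def, eLpNorm_congr_ae hae, eLpNorm_const_smul, ENNReal.toReal_mul, toReal_enorm,
    mul_comm]
  gcongr
  exact ENNReal.toReal_le_of_le_ofReal hcpos.le hmink

/-! ### Cutoff functions -/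

/-- Equality with `1` on a neighbourhood of each point of `K`, not only on `K`, makes the
derivatives agree there as well. -/
lemma exists_cutoff {d : ℕ} {B K : Set (Euc d)} (hB : IsOpen B) (hK : IsCompact K) (hKB : K ⊆ B) :
    ∃ χ : Euc d → ℝ, ContDiff ℝ 1 χ ∧ HasCompactSupport χ ∧ tsupport χ ⊆ B ∧
      ∀ y ∈ K, χ =ᶠ[𝓝 y] 1 := by
  obtain ⟨L, hL, hKL, hLB⟩ := exists_compact_between hK hB hKB
  obtain ⟨χ, h0, h1, -⟩ := exists_contMDiffMap_zero_one_nhds_of_isClosed (n := 1)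
    (modelWithCornersSelf ℝ (Euc d)) (s := (interior L)ᶜ) (t := K)
    isOpen_interior.isClosed_compl hK.isClosed
    (Set.disjoint_compl_left_iff_subset.2 hKL)
  have hsupp : tsupport χ ⊆ L := by
    refine closure_minimal (fun y hy => ?_) hL.isClosed
    by_contra hyL
    have : y ∈ (interior L)ᶜ := fun h => hyL (interior_subset h)
    exact hy (h0.self_of_nhdsSet y this)
  refine ⟨χ, χ.contMDiff.contDiff, HasCompactSupport.of_support_subset_isCompact hL
    (subset_closure.trans hsupp), hsupp.trans hLB, fun y hy => ?_⟩
  exact h1.filter_mono (nhds_le_nhdsSet hy)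

section Cutoff

variable {d : ℕ}

lemma continuous_smul_of_tsupport_subset {E : Type*} [NormedAddCommGroup E] [NormedSpace ℝ E]
    {B : Set (Euc d)} (hB : IsOpen B) {χ : Euc d → ℝ} (hχ : Continuous χ) (hχB : tsupport χ ⊆ B)
    {G : Euc d → E} (hG : ContinuousOn G B) : Continuous fun y => χ y • G y :=
  continuous_of_tsupport fun _ hy => hχ.continuousAt.smul
    (hG.continuousAt (hB.mem_nhds (hχB (tsupport_smul_subset_left χ G hy))))

lemma jet_mul {k l : Euc d → ℝ} {y : Euc d} (hk : DifferentiableAt ℝ k y)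
    (hl : DifferentiableAt ℝ l y) (j : Fin d) :
    jet (fun y => k y * l y) y (some j) = k y * jet l y (some j) + l y * jet k y (some j) := by
  simp [jet, fderiv_fun_mul hk hl]

lemma jet_congr {k l : Euc d → ℝ} {y : Euc d} (h : k =ᶠ[𝓝 y] l) (i : Option (Fin d)) :
    jet k y i = jet l y i := by
  cases i with
  | none => exact h.eq_of_nhds
  | some j => simp only [jet, h.fderiv_eq]

lemma jet_zero (y : Euc d) (i : Option (Fin d)) : jet (fun _ => 0) y i = 0 := by
  cases i <;> simp [jet]

lemma contDiff_cutoff_mul {X : Type*} [NormedAddCommGroup X] [NormedSpace ℝ X] {B : Set (Euc d)}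
    (hB : IsOpen B) {χ : Euc d → ℝ} (hχ : ContDiff ℝ 1 χ) (hχB : tsupport χ ⊆ B)
    {f : X → Euc d → ℝ} (hf : ContDiffOn ℝ 1 (Function.uncurry f) (Set.univ ×ˢ B)) :
    ContDiff ℝ 1 fun z : X × Euc d => χ z.2 * f z.1 z.2 := by
  rw [contDiff_iff_contDiffAt]
  intro z
  by_cases hz : z.2 ∈ B
  · have h1 : ContDiffAt ℝ 1 (Function.uncurry f) z :=
      hf.contDiffAt ((isOpen_univ.prod hB).mem_nhds ⟨Set.mem_univ _, hz⟩)
    exact (hχ.comp contDiff_snd).contDiffAt.mul h1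
  · have h1 : χ =ᶠ[𝓝 z.2] 0 := notMem_tsupport_iff_eventuallyEq.1 fun h => hz (hχB h)
    have h2 : (fun z : X × Euc d => χ z.2 * f z.1 z.2) =ᶠ[𝓝 z] fun _ => 0 := by
      filter_upwards [continuousAt_snd.eventually h1] with w hw
      rw [hw, Pi.zero_apply, zero_mul]
    exact contDiffAt_const.congr_of_eventuallyEq h2

/-- The extension is by zero; its values outside `B` are later multiplied by a cutoff that vanishes
there. -/
lemma exists_continuousOn_extension {α E : Type*} [TopologicalSpace α] [TopologicalSpace E] [Zero E]
    {B : Set α} {G : B → E} (hG : Continuous G) :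
    ∃ G' : α → E, ContinuousOn G' B ∧ ∀ y : B, G' y = G y := by
  have h : ∀ y : B, Function.extend Subtype.val G 0 y = G y :=
    Subtype.val_injective.extend_apply G 0
  refine ⟨_, ?_, h⟩
  rw [continuousOn_iff_continuous_domRestrict]
  exact hG.congr fun y => (h y).symm

end Cutoff

/-! ### The scalar case -/

section Component

variable {dx dy : ℕ} {μ : Measure (Euc dx)} [IsProbabilityMeasure μ] {p : ℝ≥0∞} [Fact (1 ≤ p)]

/-- The approximation theorem for real-valued functions. -/
lemma exists_isGeluNet_jet_near (hp : p ≠ ∞) {B : Set (Euc dy)} (hB : IsOpen B)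
    {f : Euc dx → Euc dy → ℝ} (hf : ContDiffOn ℝ 1 (Function.uncurry f) (Set.univ ×ˢ B))
    {G : Option (Fin dy) → Euc dy → Lp ℝ p μ} (hG : ∀ i, ContinuousOn (G i) B)
    (hGf : ∀ y ∈ B, ∀ i, G i y =ᵐ[μ] fun x => jet (f x) y i) {K : Set (Euc dy)}
    (hK : IsCompact K) (hKB : K ⊆ B) {ε : ℝ} (hε : 0 < ε) :
    ∃ n : Euc dx × Euc dy → ℝ, IsGeluNet netInput n ∧ ∀ y ∈ K, ∀ i,
      AEStronglyMeasurable (fun x => jet (f x) y i - jet (fun y => n (x, y)) y i) μ ∧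
      eLpNorm (fun x => jet (f x) y i - jet (fun y => n (x, y)) y i) p μ ≤ ENNReal.ofReal ε := by
  obtain ⟨χ, hχ, hχc, hχB, hχK⟩ := exists_cutoff hB hK hKB
  set h : Euc dx × Euc dy → ℝ := fun z => χ z.2 * f z.1 z.2 with hdef
  have hh : ContDiff ℝ 1 h := contDiff_cutoff_mul hB hχ hχB hf
  -- `H` is the `L^p`-valued jet of `χ f`, written with the product rule.
  let H : Euc dy → Option (Fin dy) → Lp ℝ p μ := fun y i =>
    i.elim (χ y • G none y) fun j => χ y • G (some j) y + jet χ y (some j) • G none y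
  have hH : Continuous H := by
    refine continuous_pi fun i => ?_
    cases i with
    | none => exact continuous_smul_of_tsupport_subset hB hχ.continuous hχB (hG none)
    | some j =>
      exact (continuous_smul_of_tsupport_subset hB hχ.continuous hχB (hG (some j))).add
        (continuous_smul_of_tsupport_subset hB (continuous_jet hχ (some j))
          ((tsupport_fderiv_apply_subset ℝ _).trans hχB) (hG none))
  have hHc : HasCompactSupport H := by
    refine HasCompactSupport.intro hχc fun y hy => ?_
    have h0 : ∀ i, jet χ y i = 0 := fun i => by
      rw [jet_congr (notMem_tsupport_iff_eventuallyEq.1 hy) i]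
      exact jet_zero y i
    have h1 : χ y = 0 := h0 none
    funext i
    cases i <;> simp [H, h1, h0]
  have hHh : ∀ y i, H y i =ᵐ[μ] fun x => jet (fun y => h (x, y)) y i := by
    intro y i
    by_cases hy : y ∈ B
    · have hfd : ∀ x, DifferentiableAt ℝ (f x) y := fun x => by
        have h1 : ContDiffAt ℝ 1 (Function.uncurry f) (x, y) :=
          hf.contDiffAt ((isOpen_univ.prod hB).mem_nhds ⟨Set.mem_univ _, hy⟩)
        exact (h1.differentiableAt one_ne_zero).comp y
          ((differentiableAt_const x).prodMk differentiableAt_id)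
      have hχd : DifferentiableAt ℝ χ y := hχ.differentiable one_ne_zero y
      cases i with
      | none =>
        filter_upwards [hGf y hy none, Lp.coeFn_smul (χ y) (G none y)] with x h1 h2
        exact h2.trans (by rw [Pi.smul_apply, h1]; rfl)
      | some j =>
        filter_upwards [hGf y hy none, hGf y hy (some j), Lp.coeFn_smul (χ y) (G (some j) y),
          Lp.coeFn_smul (jet χ y (some j)) (G none y),
          Lp.coeFn_add (χ y • G (some j) y) (jet χ y (some j) • G none y)] with x h1 h2 h3 h4 h5
        refine h5.trans ?_
        rw [Pi.add_apply, h3, h4, Pi.smul_apply, Pi.smul_apply, h1, h2, jet_mul hχd (hfd x)]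
        simp only [smul_eq_mul, jet]
        ring
    · have hy' : y ∉ tsupport χ := fun h => hy (hχB h)
      have h0 : H y i = 0 := by
        have h1 := notMem_tsupport_iff_eventuallyEq.1 hy'
        have h2 : ∀ i, jet χ y i = 0 := fun i => (jet_congr h1 i).trans (jet_zero y i)
        have h3 : χ y = 0 := h2 none
        cases i <;> simp [H, h3, h2]
      rw [h0]
      filter_upwards [Lp.coeFn_zero ℝ p μ] with x hx
      rw [hx, Pi.zero_apply]
      refine ((jet_congr ?_ i).trans (jet_zero y i)).symm
      filter_upwards [notMem_tsupport_iff_eventuallyEq.1 hy'] with w hw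
      simp [hdef, hw]
  have hHd : ∀ z j, HasLineDerivAt ℝ (fun z => H z none) (H z (some j)) z
      (EuclideanSpace.single j 1) := by
    intro z j
    have hline : ∀ t : ℝ, HasDerivAt (fun t : ℝ => z + t • EuclideanSpace.single j (1 : ℝ))
        (EuclideanSpace.single j 1) t := fun t => by
      simpa using ((hasDerivAt_id t).smul_const (EuclideanSpace.single j (1 : ℝ))).const_add z
    have hcl : Continuous fun t : ℝ => z + t • EuclideanSpace.single j (1 : ℝ) := by fun_prop
    -- Restricted to a line, the cut-off function is differentiable for every `x`, with a jointly
    -- continuous derivative because `h` is `C^1`; continuity of `H` supplies the continuity in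
    -- `L^p`.
    have := hasDerivAt_Lp μ hp (t₀ := 0)
      (φ := fun t x => h (x, z + t • EuclideanSpace.single j (1 : ℝ)))
      (φ' := fun t x => jet (fun y => h (x, y)) (z + t • EuclideanSpace.single j (1 : ℝ)) (some j))
      (u := fun t => H (z + t • EuclideanSpace.single j (1 : ℝ)) none)
      (u' := fun t => H (z + t • EuclideanSpace.single j (1 : ℝ)) (some j))
      (fun t x => HasFDerivAt.comp_hasDerivAt (l := fun y => h (x, y)) t (hh.hasFDerivAt_fderivSnd
        (x, z + t • EuclideanSpace.single j (1 : ℝ))) (hline t))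
      ((hh.continuous_fderivSnd.comp
        (continuous_snd.prodMk (hcl.comp continuous_fst))).clm_apply continuous_const)
      (fun t => hHh _ none) (fun t => hHh _ (some j))
      (((continuous_apply (some j)).comp (hH.comp hcl)).continuousAt)
    simpa [HasLineDerivAt] using this
  obtain ⟨n, hn, hnH⟩ := mem_netSubmodule.1
    (mem_netSubmodule_of_hasLineDerivAt hp hK hH hHc hHd) ε hε
  refine ⟨n, hn, fun y hy i => ?_⟩
  have hae : (fun x => H y i x - jet (fun y => n (x, y)) y i) =ᵐ[μ]
      fun x => jet (f x) y i - jet (fun y => n (x, y)) y i := by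
    filter_upwards [hHh y i] with x hx
    rw [hx]
    congr 1
    refine jet_congr ?_ i
    filter_upwards [hχK y hy] with w hw
    simp [hdef, hw]
  constructor
  · exact ((Lp.aestronglyMeasurable (H y i)).sub
      (continuous_jet_fst hn.contDiff y i).aestronglyMeasurable).congr hae
  · rw [← eLpNorm_congr_ae hae]
    exact hnH ⟨y, hy⟩ i

end Component

/-! ### Components of vectors and matrices -/

lemma sqrt_sum_sq_le_sum_abs {ι : Type*} (s : Finset ι) (f : ι → ℝ) :
    √(∑ i ∈ s, f i ^ 2) ≤ ∑ i ∈ s, |f i| := by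
  refine Real.sqrt_le_iff.2 ⟨Finset.sum_nonneg fun _ _ => abs_nonneg _, ?_⟩
  simpa using Finset.sum_sq_le_sq_sum_of_nonneg (s := s) (f := fun i => |f i|)
    fun _ _ => abs_nonneg _

lemma frobenius_norm_eq_sqrt {m n : ℕ} (A : Matrix (Fin m) (Fin n) ℝ) :
    ‖A‖ = √(∑ ij : Fin m × Fin n, A ij.1 ij.2 ^ 2) := by
  rw [Matrix.frobenius_norm_def, Real.sqrt_eq_rpow, Fintype.sum_prod_type]
  simp

lemma lipschitzWith_matrix_entry {m n : ℕ} (i : Fin m) (j : Fin n) :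
    LipschitzWith 1 fun A : Matrix (Fin m) (Fin n) ℝ => A i j := by
  refine LipschitzWith.of_dist_le_mul fun A A' => ?_
  rw [NNReal.coe_one, one_mul, dist_eq_norm, dist_eq_norm, frobenius_norm_eq_sqrt]
  refine Real.le_sqrt_of_sq_le ?_
  rw [Real.norm_eq_abs, sq_abs]
  exact Finset.single_le_sum (f := fun ij : Fin m × Fin n => (A - A') ij.1 ij.2 ^ 2)
    (fun _ _ => sq_nonneg _) (Finset.mem_univ (i, j))

lemma lipschitzWith_euclidean_coord {m : ℕ} (i : Fin m) :
    LipschitzWith 1 fun v : Euc m => v i :=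
  LipschitzWith.of_dist_le_mul fun v w => by
    rw [NNReal.coe_one, one_mul, dist_eq_norm, dist_eq_norm]
    exact PiLp.norm_apply_le (v - w) i

/-- Composition with a Lipschitz map vanishing at `0` is continuous on `L^p`; this passes the vector
and matrix hypotheses to single entries. -/
lemma exists_continuousOn_Lp_comp {α β V : Type*} [MeasurableSpace α] [TopologicalSpace β]
    [NormedAddCommGroup V] {μ : Measure α} {p : ℝ≥0∞} [Fact (1 ≤ p)] {B : Set β}
    {F : β → α → V} (hL : ∀ y : B, MemLp (F y) p μ) (hc : Continuous fun y : B => (hL y).toLp (F y))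
    {φ : V → ℝ} (hφ : LipschitzWith 1 φ) (hφ0 : φ 0 = 0) :
    ∃ G : β → Lp ℝ p μ, ContinuousOn G B ∧ ∀ y ∈ B, G y =ᵐ[μ] fun x => φ (F y x) := by
  obtain ⟨G, hG, h⟩ := exists_continuousOn_extension
    ((hφ.continuous_compLp hφ0).comp hc)
  refine ⟨G, hG, fun y hy => ?_⟩
  have h1 : G y = hφ.compLp hφ0 ((hL ⟨y, hy⟩).toLp (F y)) := h ⟨y, hy⟩
  rw [h1]
  filter_upwards [hφ.coeFn_compLp hφ0 ((hL ⟨y, hy⟩).toLp (F y)), (hL ⟨y, hy⟩).coeFn_toLp]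
    with x h2 h3
  rw [h2, Function.comp_apply, h3]

lemma eLpNorm_le_card_mul {α V ι : Type*} [MeasurableSpace α] [NormedAddCommGroup V] [Fintype ι]
    {μ : Measure α} {p : ℝ≥0∞} (hp1 : 1 ≤ p) {F : α → V} {f : ι → α → ℝ}
    (hf : ∀ i, AEStronglyMeasurable (f i) μ) (hF : ∀ x, ‖F x‖ ≤ ∑ i, |f i x|) {δ : ℝ}
    (hδ : ∀ i, eLpNorm (f i) p μ ≤ ENNReal.ofReal δ) :
    eLpNorm F p μ ≤ ENNReal.ofReal (Fintype.card ι * δ) := by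
  calc eLpNorm F p μ ≤ eLpNorm (∑ i, fun x => |f i x|) p μ := by
        refine eLpNorm_mono_real fun x => (hF x).trans_eq ?_
        rw [Finset.sum_apply]
    _ ≤ ∑ i, eLpNorm (fun x => |f i x|) p μ :=
        eLpNorm_sum_le (fun i _ => (hf i).norm) hp1
    _ ≤ ∑ _ : ι, ENNReal.ofReal δ :=
        Finset.sum_le_sum fun i _ => (eLpNorm_norm (f i)).trans_le (hδ i)
    _ = ENNReal.ofReal (Fintype.card ι * δ) := by
        rw [ENNReal.ofReal_mul (by positivity)]; simp

lemma jacobianY_apply {dx dy dg : ℕ} {g : Euc dx → Euc dy → Euc dg} {x : Euc dx} {y : Euc dy}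
    (h : DifferentiableAt ℝ (g x) y) (i : Fin dg) (j : Fin dy) :
    jacobianY g x y i j = jet (fun y => g x y i) y (some j) := by
  have := ((EuclideanSpace.proj i : Euc dg →L[ℝ] ℝ).hasFDerivAt.comp y h.hasFDerivAt).fderiv
  have h2 : fderiv ℝ (fun y => g x y i) y =
      (EuclideanSpace.proj i : Euc dg →L[ℝ] ℝ).comp (fderiv ℝ (g x) y) := this
  simp [jacobianY, jet, h2]

/-! ### Assembling the components -/

theorem theoremC1 (dx dy dg : ℕ)
    (B : Set (EuclideanSpace ℝ (Fin dy))) (hB : IsOpen B)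
    (g : EuclideanSpace ℝ (Fin dx) → EuclideanSpace ℝ (Fin dy) → EuclideanSpace ℝ (Fin dg))
    (hg : ContDiffOn ℝ 1 (Function.uncurry g) (Set.univ ×ˢ B))
    (μ : Measure (EuclideanSpace ℝ (Fin dx))) [IsProbabilityMeasure μ]
    (p : ℝ≥0∞) [Fact (1 ≤ p)] (hp : p ≠ ∞)
    (hgLp : ∀ y : B, MemLp (fun x => g x y) p μ)
    (hgcont : Continuous fun y : B => (hgLp y).toLp (fun x => g x y))
    (hDgLp : ∀ y : B, MemLp (fun x => jacobianY g x y) p μ)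
    (hDgcont : Continuous fun y : B => (hDgLp y).toLp (fun x => jacobianY g x y))
    (ε : ℝ) (hε : 0 < ε)
    (K : Set (EuclideanSpace ℝ (Fin dy))) (hK : IsCompact K) (hKB : K ⊆ B) :
    ∃ θ : DenseNet dg (dx + dy), 0 < θ.depth ∧
      (⨆ y ∈ K, ((∫⁻ x, ‖g x y - θ.toFun x y‖ₑ ^ p.toReal ∂μ) +
          (∫⁻ x, ‖jacobianY g x y - jacobianY θ.toFun x y‖ₑ ^ p.toReal ∂μ)))
        < ENNReal.ofReal (ε ^ p.toReal) := by
  have hp1 : 1 ≤ p := Fact.out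
  have hr1 : 1 ≤ p.toReal := by
    simpa using ENNReal.toReal_mono hp hp1
  have hgd : ∀ x, ∀ y ∈ B, DifferentiableAt ℝ (g x) y := fun x y hy => by
    have h1 : ContDiffAt ℝ 1 (Function.uncurry g) (x, y) :=
      hg.contDiffAt ((isOpen_univ.prod hB).mem_nhds ⟨Set.mem_univ _, hy⟩)
    exact (h1.differentiableAt one_ne_zero).comp y
      ((differentiableAt_const x).prodMk differentiableAt_id)
  have hgi : ∀ i : Fin dg,
      ContDiffOn ℝ 1 (Function.uncurry fun x y => g x y i) (Set.univ ×ˢ B) := fun i =>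
    (EuclideanSpace.proj i : Euc dg →L[ℝ] ℝ).contDiff.comp_contDiffOn hg
  -- There are `dg` value components and `dg * dy` derivative components; the `+ 1` keeps the
  -- denominator nonzero.
  set δ : ℝ := ε / (4 * (dg + dg * dy + 1)) with hδdef
  have hδ : 0 < δ := by positivity
  have hcomp : ∀ i : Fin dg, ∃ n : Euc dx × Euc dy → ℝ, IsGeluNet netInput n ∧ ∀ y ∈ K, ∀ o,
      AEStronglyMeasurable
        (fun x => jet (fun y => g x y i) y o - jet (fun y => n (x, y)) y o) μ ∧
      eLpNorm (fun x => jet (fun y => g x y i) y o - jet (fun y => n (x, y)) y o) p μ ≤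
        ENNReal.ofReal δ := by
    intro i
    obtain ⟨G₀, hG₀, hG₀g⟩ := exists_continuousOn_Lp_comp
      (F := fun y x => g x y) hgLp hgcont
      (lipschitzWith_euclidean_coord i) rfl
    choose G₁ hG₁ hG₁g using fun j : Fin dy => exists_continuousOn_Lp_comp
      (F := fun y x => jacobianY g x y) hDgLp hDgcont
      (lipschitzWith_matrix_entry i j) rfl
    refine exists_isGeluNet_jet_near hp hB (hgi i) (G := fun o => o.elim G₀ G₁) ?_ ?_ hK hKB hδ
    · rintro (_ | j)
      · exact hG₀
      · exact hG₁ j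
    · rintro y hy (_ | j)
      · exact hG₀g y hy
      · filter_upwards [hG₁g j y hy] with x hx
        rw [← jacobianY_apply (hgd x y hy)]
        exact hx
  choose n hn hnδ using hcomp
  obtain ⟨θ, hθ0, hθ⟩ := exists_denseNet_of_isGeluNet n hn
  have hθn : ∀ x y i, θ.toFun x y i = n i (x, y) := fun x y i => congrFun (hθ (x, y)) i
  have hθd : ∀ x y, DifferentiableAt ℝ (θ.toFun x) y := fun x y => by
    rw [differentiableAt_euclidean]
    intro i
    simp only [hθn]
    exact (hn i).contDiff.differentiableAt_snd x y
  refine ⟨θ, hθ0, ?_⟩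
  have hsmall : ∀ N : ℝ, N ≤ dg + dg * dy + 1 → N * δ ≤ ε / 4 := fun N hN => by
    calc N * δ ≤ (dg + dg * dy + 1) * δ := by gcongr
      _ = ε / 4 := by rw [hδdef]; field_simp
  have hdg : (0 : ℝ) ≤ dg := by positivity
  have hdgdy : (0 : ℝ) ≤ dg * dy := by positivity
  have h0 : ∀ y ∈ K, eLpNorm (fun x => g x y - θ.toFun x y) p μ ≤ ENNReal.ofReal (ε / 4) := by
    intro y hy
    refine (eLpNorm_le_card_mul hp1 (fun i => (hnδ i y hy none).1) (fun x => ?_)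
      fun i => (hnδ i y hy none).2).trans (ENNReal.ofReal_le_ofReal (hsmall _ ?_))
    · rw [EuclideanSpace.norm_eq]
      simp only [Real.norm_eq_abs, sq_abs]
      refine (sqrt_sum_sq_le_sum_abs _ _).trans_eq ?_
      simp only [PiLp.sub_apply, hθn, jet]
    · rw [Fintype.card_fin]; linarith
  have h1 : ∀ y ∈ K, eLpNorm (fun x => jacobianY g x y - jacobianY θ.toFun x y) p μ ≤
      ENNReal.ofReal (ε / 4) := by
    intro y hy
    refine (eLpNorm_le_card_mul (ι := Fin dg × Fin dy) hp1
      (fun ij => (hnδ ij.1 y hy (some ij.2)).1) (fun x => ?_)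
      fun ij => (hnδ ij.1 y hy (some ij.2)).2).trans (ENNReal.ofReal_le_ofReal (hsmall _ ?_))
    · rw [frobenius_norm_eq_sqrt]
      refine (sqrt_sum_sq_le_sum_abs _ _).trans_eq ?_
      simp only [Matrix.sub_apply, jacobianY_apply (hgd x y (hKB hy)), jacobianY_apply (hθd x y),
        hθn]
    · rw [Fintype.card_prod, Fintype.card_fin, Fintype.card_fin]; push_cast; linarith
  -- The bound `ε / 2`, uniform in `y`, keeps the inequality strict after the supremum.
  -- Superadditivity of `t ↦ t ^ p` for `p ≥ 1` merges the two terms with bound `ε / 4`.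
  have hε2 : (ENNReal.ofReal (ε / 2)) ^ p.toReal < ENNReal.ofReal (ε ^ p.toReal) := by
    rw [ENNReal.ofReal_rpow_of_pos (by positivity)]
    refine (ENNReal.ofReal_lt_ofReal_iff (by positivity)).2 ?_
    exact Real.rpow_lt_rpow (by positivity) (by linarith) (by linarith)
  refine (iSup₂_le fun y hy => ?_).trans_lt hε2
  calc _ ≤ ENNReal.ofReal (ε / 4) ^ p.toReal + ENNReal.ofReal (ε / 4) ^ p.toReal :=
        add_le_add ((eLpNorm_le_iff_lintegral_rpow_le hp1 hp).1 (h0 y hy))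
          ((eLpNorm_le_iff_lintegral_rpow_le hp1 hp).1 (h1 y hy))
    _ ≤ (ENNReal.ofReal (ε / 4) + ENNReal.ofReal (ε / 4)) ^ p.toReal :=
        ENNReal.add_rpow_le_rpow_add _ _ hr1
    _ = ENNReal.ofReal (ε / 2) ^ p.toReal := by
        rw [← ENNReal.ofReal_add (by positivity) (by positivity)]
        congr 2
        ring
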